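/- Let $\mathbb K$ be a field of characteristic zero, $n\ge 1$, and let $d_0,\dots,d_n$ be positive integers. Let $\mathbf D=\mathbb K\langle x_0,\dots,x_n,\partial_0,\dots,\partial_n\rangle$ be the Weyl algebra, graded by $\deg x_i=d_i$, $\deg\partial_i=-d_i$, let $E=\sum_i d_i x_i\partial_i$ be the Euler field, and let $J=(x_0,\dots,x_n)\subset\mathbb K[x_0,\dots,x_n]$. For a $\mathbf D$-module $M$ and $\mu\in\mathbb K$ put $M^\mu=\{m\in M: Em=\mu m\}$. For $\lambda\in\mathbb K$, a $\mathbf D$-module $M$ is called $\lambda$-Euler if $M=\bigoplus_{k\in\mathbb Z}M^{\lambda+k}$; it is then graded by $M_k=M^{\lambda+k}$. It is called torsion if every $m\in M$ satisfies $J^km=0$ for some $k$. The category $\mathcal D^\lambda_{[\mathbb P(V)]}\text{-Qcoh}$ of $\lambda$-twisted D-modules on the weighted projective stack $[\mathbb P(V)]$ with weights $d_0,\dots,d_n$ is the quotient of the category of $\lambda$-Euler $\mathbf D$-modules by the subcategory of torsion modules. Let $\omega$ be the right adjoint of the quotient functor, and let $$\Gamma_\lambda:\ \mathcal D^\lambda_{[\mathbb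 P(V)]}\text{-Qcoh}\longrightarrow \mathbf D_0/\mathbf D_0(E-\lambda)\text{-Mod},\qquad \Gamma_\lambda(\mathcal M)=\omega(\mathcal M)_0=\omega(\mathcal M)^\lambda$$ be the global sections functor. Let $\operatorname{Ker}\Gamma_\lambda$ be the full subcategory of those $\mathcal M$ with $\Gamma_\lambda(\mathcal M)=0$, and let $\mathcal A=\sum_i\mathbb Z_{\ge 0}\,d_i$. (1) If $\gcd(d_0,\dots,d_n)=1$ and $\lambda\in(\mathbb K\setminus\mathbb Z)\cup\mathcal A$, then $\operatorname{Ker}\Gamma_\lambda$ is the zero category: every $\mathcal M$ with $\Gamma_\lambda(\mathcal M)=0$ is a zero object, so every nonzero $\lambda$-twisted D-module has nonzero global sections. (2) If $\gcd(d_0,\dots,d_n)>1$, then for every $\lambda\in\mathbb K$ the category $\operatorname{Ker}\Gamma_\lambda$ contains a nonzero object. -/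

import Mathlib

open CategoryTheory

universe u

noncomputable section

namespace WeightedDMod

/-! ## The Weyl algebra -/

/-- The defining relations of the Weyl algebra: the generators are `xᵢ = Sum.inl i` and
`∂ᵢ = Sum.inr i`. -/
inductive WeylRel (K : Type u) [Field K] (ι : Type) [DecidableEq ι] :
    FreeAlgebra K (ι ⊕ ι) → FreeAlgebra K (ι ⊕ ι) → Prop
  | x_x (i j : ι) : WeylRel K ι
      (FreeAlgebra.ι K (Sum.inl i) * FreeAlgebra.ι K (Sum.inl j))
      (FreeAlgebra.ι K (Sum.inl j) * FreeAlgebra.ι K (Sum.inl i))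
  | del_del (i j : ι) : WeylRel K ι
      (FreeAlgebra.ι K (Sum.inr i) * FreeAlgebra.ι K (Sum.inr j))
      (FreeAlgebra.ι K (Sum.inr j) * FreeAlgebra.ι K (Sum.inr i))
  | del_x (i j : ι) : WeylRel K ι
      (FreeAlgebra.ι K (Sum.inr i) * FreeAlgebra.ι K (Sum.inl j))
      (FreeAlgebra.ι K (Sum.inl j) * FreeAlgebra.ι K (Sum.inr i) + if i = j then 1 else 0)

/-- The Weyl algebra `K⟨xᵢ, ∂ᵢ⟩` on the index set `ι`. -/
def Weyl (K : Type u) [Field K] (ι : Type) [DecidableEq ι] : Type u :=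
  RingQuot (WeylRel K ι)

section Weyl

variable (K : Type u) [Field K] (ι : Type) [DecidableEq ι]

instance : Ring (Weyl K ι) := inferInstanceAs (Ring (RingQuot (WeylRel K ι)))

instance : Algebra K (Weyl K ι) := inferInstanceAs (Algebra K (RingQuot (WeylRel K ι)))

variable {ι}

/-- The generators of the Weyl algebra: `gen (Sum.inl i) = xᵢ`, `gen (Sum.inr i) = ∂ᵢ`. -/
def gen (s : ι ⊕ ι) : Weyl K ι :=
  RingQuot.mkAlgHom K (WeylRel K ι) (FreeAlgebra.ι K s)

/-- The coordinate `xᵢ`. -/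
def x (i : ι) : Weyl K ι := gen K (Sum.inl i)

/-- The derivation `∂ᵢ`. -/
def del (i : ι) : Weyl K ι := gen K (Sum.inr i)

lemma x_mul_x (i j : ι) : x K i * x K j = x K j * x K i := by
  have h := RingQuot.mkAlgHom_rel K (WeylRel.x_x (K := K) i j)
  rw [map_mul, map_mul] at h
  exact h

lemma del_mul_del (i j : ι) : del K i * del K j = del K j * del K i := by
  have h := RingQuot.mkAlgHom_rel K (WeylRel.del_del (K := K) i j)
  rw [map_mul, map_mul] at h
  exact h

lemma del_mul_x (i j : ι) :
    del K i * x K j = x K j * del K i + if i = j then 1 else 0 := by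
  have h := RingQuot.mkAlgHom_rel K (WeylRel.del_x (K := K) i j)
  rw [map_mul, map_add, map_mul] at h
  have e : RingQuot.mkAlgHom K (WeylRel K ι) (if i = j then 1 else 0) =
      (if i = j then 1 else 0 : Weyl K ι) := by
    split_ifs
    · exact map_one _
    · exact map_zero _
  rw [e] at h
  exact h

variable {K}

lemma weyl_induction {P : Weyl K ι → Prop}
    (h0 : ∀ c : K, P (algebraMap K (Weyl K ι) c)) (hx : ∀ i, P (x K i)) (hd : ∀ i, P (del K i))
    (hadd : ∀ a b, P a → P b → P (a + b)) (hmul : ∀ a b, P a → P b → P (a * b))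
    (a : Weyl K ι) : P a := by
  obtain ⟨b, rfl⟩ := RingQuot.mkAlgHom_surjective K (WeylRel K ι) a
  induction b using FreeAlgebra.induction with
  | grade0 r => rw [AlgHom.commutes]; exact h0 r
  | grade1 s =>
    cases s with
    | inl i => exact hx i
    | inr i => exact hd i
  | mul a b ha hb => rw [map_mul]; exact hmul _ _ ha hb
  | add a b ha hb => rw [map_add]; exact hadd _ _ ha hb

end Weyl

section Main

variable {K : Type u} [Field K] {ι : Type} [Fintype ι] [DecidableEq ι]

/-! ## The Euler field and the grading with `deg xᵢ = dᵢ`, `deg ∂ᵢ = -dᵢ` -/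

/-- The Euler field `E = ∑ᵢ dᵢ xᵢ ∂ᵢ`. -/
def euler (K : Type u) [Field K] (d : ι → ℕ) : Weyl K ι :=
  ∑ i, (d i : Weyl K ι) * (x K i * del K i)

/-- The degree of a generator: `deg xᵢ = dᵢ` and `deg ∂ᵢ = -dᵢ`. -/
def genDegree (d : ι → ℕ) : ι ⊕ ι → ℤ :=
  Sum.elim (fun i => (d i : ℤ)) (fun i => -(d i : ℤ))

/-- The homogeneous part of degree `k` of the Weyl algebra: the span of the words of degree `k`
in the generators. -/
def homogeneousPart (K : Type u) [Field K] (d : ι → ℕ) (k : ℤ) : Submodule K (Weyl K ι) :=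
  Submodule.span K {a | ∃ w : List (ι ⊕ ι), (w.map (genDegree d)).sum = k ∧ (w.map (gen K)).prod = a}

lemma euler_comm_x (d : ι → ℕ) (i : ι) :
    euler K d * x K i = x K i * euler K d + algebraMap K _ (d i : K) * x K i := by
  have h : ∀ j, (d j : Weyl K ι) * (x K j * del K j) * x K i =
      x K i * ((d j : Weyl K ι) * (x K j * del K j)) +
        if j = i then (d j : Weyl K ι) * x K j else 0 := by
    intro j
    have e1 : x K i * ((d j : Weyl K ι) * (x K j * del K j)) =
        (d j : Weyl K ι) * (x K j * (x K i * del K j)) := by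
      rw [← mul_assoc (x K i), ← Nat.cast_comm, mul_assoc, ← mul_assoc (x K i), x_mul_x, mul_assoc]
    rw [e1, mul_assoc, mul_assoc, del_mul_x]
    split_ifs <;> simp [mul_add]
  rw [euler, Finset.sum_mul, Finset.sum_congr rfl (fun j _ => h j), Finset.sum_add_distrib,
    Finset.mul_sum]
  simp

lemma euler_comm_del (d : ι → ℕ) (i : ι) :
    euler K d * del K i = del K i * euler K d + algebraMap K _ (-(d i : K)) * del K i := by
  have h : ∀ j, (d j : Weyl K ι) * (x K j * del K j) * del K i =
      del K i * ((d j : Weyl K ι) * (x K j * del K j)) +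
        if j = i then -((d j : Weyl K ι) * del K j) else 0 := by
    intro j
    have e1 : del K i * ((d j : Weyl K ι) * (x K j * del K j)) =
        (d j : Weyl K ι) * ((del K i * x K j) * del K j) := by
      rw [← mul_assoc (del K i), ← Nat.cast_comm, mul_assoc, mul_assoc]
    rw [e1, mul_assoc, mul_assoc, del_mul_x, del_mul_del, add_mul, mul_add, mul_assoc]
    by_cases hij : j = i
    · subst hij; simp
    · simp [hij, Ne.symm hij]
  rw [euler, Finset.sum_mul, Finset.sum_congr rfl (fun j _ => h j), Finset.sum_add_distrib,
    Finset.mul_sum]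
  simp

lemma euler_comm_gen (d : ι → ℕ) (s : ι ⊕ ι) :
    euler K d * gen K s = gen K s * euler K d + algebraMap K _ (genDegree d s : K) * gen K s := by
  cases s with
  | inl i => simpa [genDegree, x] using euler_comm_x (K := K) d i
  | inr i => simpa [genDegree, del] using euler_comm_del (K := K) d i

lemma euler_comm_of_mem (d : ι → ℕ) {k : ℤ} {a : Weyl K ι} (ha : a ∈ homogeneousPart K d k) :
    euler K d * a = a * euler K d + algebraMap K _ (k : K) * a := by
  induction ha using Submodule.span_induction with
  | mem a ha =>
    obtain ⟨w, rfl, rfl⟩ := ha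
    induction w with
    | nil => simp
    | cons s w ih =>
      simp only [List.map_cons, List.prod_cons, List.sum_cons, Int.cast_add, map_add]
      rw [← mul_assoc, euler_comm_gen, add_mul, mul_assoc, ih, mul_add, mul_assoc, mul_assoc,
        ← mul_assoc (gen K s) (algebraMap K _ _), ← Algebra.commutes, mul_assoc, add_mul]
      abel
  | zero => simp
  | add a b _ _ ha hb => rw [mul_add, ha, hb, add_mul, mul_add]; abel
  | smul c a _ ha =>
    rw [mul_smul_comm, ha, smul_add, smul_mul_assoc, mul_smul_comm]

lemma mul_mem_homogeneousPart (d : ι → ℕ) {k l : ℤ} {a b : Weyl K ι}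
    (ha : a ∈ homogeneousPart K d k) (hb : b ∈ homogeneousPart K d l) :
    a * b ∈ homogeneousPart K d (k + l) := by
  induction ha using Submodule.span_induction with
  | mem a ha =>
    obtain ⟨w, rfl, rfl⟩ := ha
    induction hb using Submodule.span_induction with
    | mem b hb =>
      obtain ⟨v, rfl, rfl⟩ := hb
      exact Submodule.subset_span ⟨w ++ v, by simp, by simp⟩
    | zero => simp
    | add a b _ _ ha hb => rw [mul_add]; exact add_mem ha hb
    | smul c a _ ha => rw [mul_smul_comm]; exact Submodule.smul_mem _ _ ha
  | zero => simp
  | add a b _ _ ha hb => rw [add_mul]; exact add_mem ha hb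
  | smul c a _ ha => rw [smul_mul_assoc]; exact Submodule.smul_mem _ _ ha

/-- The subalgebra of elements of degree zero in the Weyl algebra. -/
def degreeZero (K : Type u) [Field K] (d : ι → ℕ) : Subalgebra K (Weyl K ι) where
  carrier := homogeneousPart K d 0
  mul_mem' ha hb := by simpa using mul_mem_homogeneousPart d ha hb
  add_mem' ha hb := add_mem ha hb
  algebraMap_mem' c := by
    rw [Algebra.algebraMap_eq_smul_one]
    exact Submodule.smul_mem _ _ (Submodule.subset_span ⟨[], by simp, by simp⟩)

lemma euler_mem_degreeZero (d : ι → ℕ) : euler K d ∈ degreeZero K d := by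
  refine sum_mem fun i _ => mul_mem (natCast_mem _ _) ?_
  exact Submodule.subset_span ⟨[Sum.inl i, Sum.inr i], by simp [genDegree], by simp [x, del]⟩

/-- The element `E - λ` of the degree zero subalgebra. -/
def eulerSub (d : ι → ℕ) (lam : K) : degreeZero K d :=
  ⟨euler K d, euler_mem_degreeZero d⟩ - algebraMap K _ lam

lemma eulerSub_comm (d : ι → ℕ) (lam : K) (a : degreeZero K d) :
    a * eulerSub d lam = eulerSub d lam * a := by
  have h := euler_comm_of_mem d a.2
  have h' : a * (⟨euler K d, euler_mem_degreeZero d⟩ : degreeZero K d) =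
      ⟨euler K d, euler_mem_degreeZero d⟩ * a := by
    apply Subtype.ext
    simpa using h.symm
  rw [eulerSub, mul_sub, sub_mul, h', Algebra.commutes]

/-- The (left, hence two-sided) ideal `𝐃₀ (E - λ)` of `𝐃₀`. -/
def eulerIdeal (d : ι → ℕ) (lam : K) : Ideal (degreeZero K d) :=
  Ideal.span {eulerSub d lam}

instance (d : ι → ℕ) (lam : K) : (eulerIdeal d lam).IsTwoSided where
  mul_mem_of_left {a} b ha := by
    obtain ⟨c, rfl⟩ := Ideal.mem_span_singleton'.1 ha
    refine Ideal.mem_span_singleton'.2 ⟨c * b, ?_⟩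
    rw [mul_assoc, mul_assoc, eulerSub_comm]

/-- The ring `𝐃₀ / 𝐃₀ (E - λ)` of globally defined twisted differential operators. -/
abbrev TwistedOps (d : ι → ℕ) (lam : K) : Type u := degreeZero K d ⧸ eulerIdeal d lam

/-! ## `λ`-Euler modules -/

/-- The eigenspace of the Euler field with eigenvalue `μ`. -/
def weightSpace (d : ι → ℕ) (μ : K) (M : Type u) [AddCommGroup M] [Module (Weyl K ι) M] :
    AddSubgroup M where
  carrier := {m | euler K d • m = algebraMap K (Weyl K ι) μ • m}
  add_mem' {a b} ha hb := by
    simp only [Set.mem_ofPred_eq] at ha hb ⊢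
    rw [smul_add, smul_add, ha, hb]
  zero_mem' := by simp
  neg_mem' {a} ha := by
    simp only [Set.mem_ofPred_eq] at ha ⊢
    rw [smul_neg, smul_neg, ha]

/-- `M` is `λ`-Euler if it is the sum of the eigenspaces of `E` for the eigenvalues `λ + k`,
`k ∈ ℤ`. (In characteristic zero these eigenvalues are distinct, so that the sum is direct.) -/
def IsEuler (d : ι → ℕ) (lam : K) (M : Type u) [AddCommGroup M] [Module (Weyl K ι) M] : Prop :=
  ⨆ k : ℤ, weightSpace d (lam + k) M = ⊤

section ModuleFacts

variable {M : Type u} [AddCommGroup M] [Module (Weyl K ι) M]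
  {N : Type u} [AddCommGroup N] [Module (Weyl K ι) N]

lemma smul_mem_weightSpace (d : ι → ℕ) {μ : K} {k : ℤ} {a : Weyl K ι} {m : M}
    (ha : a ∈ homogeneousPart K d k) (hm : m ∈ weightSpace d μ M) :
    a • m ∈ weightSpace d (μ + k) M := by
  change euler K d • m = _ at hm
  change euler K d • (a • m) = _
  rw [smul_smul, euler_comm_of_mem d ha, add_smul, mul_smul, hm, smul_smul, ← Algebra.commutes,
    mul_smul, map_add, add_smul, mul_smul]

lemma map_mem_weightSpace (d : ι → ℕ) {μ : K} (f : M →ₗ[Weyl K ι] N) {m : M}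
    (hm : m ∈ weightSpace d μ M) : f m ∈ weightSpace d μ N := by
  change euler K d • m = _ at hm
  change euler K d • f m = _
  rw [← map_smul, hm, map_smul]

end ModuleFacts

instance (d : ι → ℕ) (μ : K) (M : Type u) [AddCommGroup M] [Module (Weyl K ι) M] :
    Module (degreeZero K d) (weightSpace d μ M) where
  smul a m := ⟨(a : Weyl K ι) • (m : M), by
    simpa using smul_mem_weightSpace d (k := 0) a.2 m.2⟩
  one_smul m := Subtype.ext (one_smul (Weyl K ι) (m : M))
  mul_smul a b m := Subtype.ext (mul_smul (a : Weyl K ι) (b : Weyl K ι) (m : M))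
  smul_zero a := Subtype.ext (smul_zero (a : Weyl K ι))
  smul_add a m m' := Subtype.ext (smul_add (a : Weyl K ι) (m : M) (m' : M))
  add_smul a b m := Subtype.ext (add_smul (a : Weyl K ι) (b : Weyl K ι) (m : M))
  zero_smul m := Subtype.ext (zero_smul (Weyl K ι) (m : M))

lemma coe_degreeZero_smul (d : ι → ℕ) (μ : K) (M : Type u) [AddCommGroup M]
    [Module (Weyl K ι) M] (a : degreeZero K d) (m : weightSpace d μ M) :
    ((a • m : weightSpace d μ M) : M) = (a : Weyl K ι) • (m : M) := rfl

/-- The action of `𝐃₀ / 𝐃₀ (E - λ)` on the `λ`-eigenspace of `E` by additive endomorphisms. -/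
def twistedAction (d : ι → ℕ) (lam : K) (M : Type u) [AddCommGroup M] [Module (Weyl K ι) M] :
    TwistedOps d lam →+* AddMonoid.End (weightSpace d lam M) :=
  Ideal.Quotient.lift (eulerIdeal d lam)
    (Module.toAddMonoidEnd (degreeZero K d) (weightSpace d lam M)) (by
      intro a ha
      obtain ⟨c, rfl⟩ := Ideal.mem_span_singleton'.1 ha
      ext m
      have hm : euler K d • (m : M) = algebraMap K (Weyl K ι) lam • (m : M) := m.2
      change (((c : Weyl K ι) * (euler K d - algebraMap K (Weyl K ι) lam)) • (m : M)) = 0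
      rw [mul_smul, sub_smul, hm, sub_self, smul_zero])

instance (d : ι → ℕ) (lam : K) (M : Type u) [AddCommGroup M] [Module (Weyl K ι) M] :
    Module (TwistedOps d lam) (weightSpace d lam M) :=
  Module.compHom _ (twistedAction d lam M)

lemma coe_twistedOps_smul (d : ι → ℕ) (lam : K) (M : Type u) [AddCommGroup M]
    [Module (Weyl K ι) M] (a : degreeZero K d) (m : weightSpace d lam M) :
    (((Ideal.Quotient.mk (eulerIdeal d lam) a) • m : weightSpace d lam M) : M) =
      (a : Weyl K ι) • (m : M) := rfl

/-! ## Torsion -/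

section Torsion

variable {M : Type u} [AddCommGroup M] [Module (Weyl K ι) M]
  {N : Type u} [AddCommGroup N] [Module (Weyl K ι) N]

/-- The monomial in the `xᵢ` given by a word. -/
def monomialX (K : Type u) [Field K] (w : List ι) : Weyl K ι := (w.map (x K)).prod

lemma monomialX_nil : monomialX K ([] : List ι) = 1 := rfl

lemma monomialX_cons (i : ι) (w : List ι) : monomialX K (i :: w) = x K i * monomialX K w := by
  simp [monomialX]

lemma monomialX_append (v w : List ι) :
    monomialX K (v ++ w) = monomialX K v * monomialX K w := by
  simp [monomialX]

lemma monomialX_mono {L : Submodule (Weyl K ι) M} {k l : ℕ} (hkl : k ≤ l) {m : M}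
    (h : ∀ w : List ι, w.length = k → monomialX K w • m ∈ L) :
    ∀ w : List ι, w.length = l → monomialX K w • m ∈ L := by
  intro w hw
  rw [← List.take_append_drop (l - k) w, monomialX_append, mul_smul]
  exact L.smul_mem _ (h _ (by rw [List.length_drop]; omega))

lemma monomialX_del {L : Submodule (Weyl K ι) M} (i : ι) (k : ℕ) : ∀ (m : M),
    (∀ w : List ι, w.length = k → monomialX K w • m ∈ L) →
    ∀ w : List ι, w.length = k + 1 → monomialX K w • (del K i • m) ∈ L := by
  induction k with
  | zero =>
    intro m h w _
    have hm : m ∈ L := by simpa [monomialX_nil] using h [] rfl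
    exact L.smul_mem _ (L.smul_mem _ hm)
  | succ k ih =>
    intro m h w hw
    obtain ⟨v, j, rfl⟩ : ∃ v j, w = v ++ [j] := by
      rcases List.eq_nil_or_concat w with h0 | ⟨v, j, h0⟩
      · simp [h0] at hw
      · exact ⟨v, j, by simpa using h0⟩
    have hv : v.length = k + 1 := by simpa using hw
    have e : monomialX K (v ++ [j]) • (del K i • m) =
        monomialX K v • (del K i • (x K j • m)) -
          (if i = j then (1 : Weyl K ι) else 0) • (monomialX K v • m) := by
      have e1 : x K j • (del K i • m) = del K i • (x K j • m) -
          (if i = j then (1 : Weyl K ι) else 0) • m := by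
        rw [smul_smul, smul_smul, del_mul_x, add_smul, add_sub_cancel_right]
      rw [monomialX_append, mul_smul]
      simp only [monomialX_cons, monomialX_nil, mul_one]
      rw [e1, smul_sub]
      split_ifs <;> simp
    rw [e]
    refine L.sub_mem (ih _ (fun u hu => ?_) v hv) (L.smul_mem _ (h v hv))
    have := h (u ++ [j]) (by simp [hu])
    rwa [monomialX_append, mul_smul, monomialX_cons, monomialX_nil, mul_one] at this

/-- `{m | ∃ k, Jᵏ m ⊆ L}`, where `J` is the ideal `(x₀, …, xₙ)` of the polynomial ring; note that
the ideal `Jᵏ` is generated by the monomials given by words of length `k`. -/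
def torsionModulo (L : Submodule (Weyl K ι) M) : Submodule (Weyl K ι) M where
  carrier := {m | ∃ k : ℕ, ∀ w : List ι, w.length = k → monomialX K w • m ∈ L}
  zero_mem' := ⟨0, fun w _ => by simp⟩
  add_mem' := by
    rintro a b ⟨k, hk⟩ ⟨l, hl⟩
    refine ⟨max k l, fun w hw => ?_⟩
    rw [smul_add]
    exact L.add_mem (monomialX_mono (le_max_left k l) hk w hw)
      (monomialX_mono (le_max_right k l) hl w hw)
  smul_mem' := by
    intro a
    induction a using weyl_induction with
    | h0 c =>
      rintro m ⟨k, hk⟩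
      refine ⟨k, fun w hw => ?_⟩
      rw [smul_smul, ← Algebra.commutes, mul_smul]
      exact L.smul_mem _ (hk w hw)
    | hx i =>
      rintro m ⟨k, hk⟩
      refine ⟨k, fun w hw => ?_⟩
      have := monomialX_mono (Nat.le_succ k) hk (w ++ [i]) (by simp [hw])
      rwa [monomialX_append, mul_smul, monomialX_cons, monomialX_nil, mul_one] at this
    | hd i =>
      rintro m ⟨k, hk⟩
      exact ⟨k + 1, monomialX_del i k m hk⟩
    | hadd a b ha hb =>
      intro m hm
      obtain ⟨k, hk⟩ := ha hm
      obtain ⟨l, hl⟩ := hb hm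
      refine ⟨max k l, fun w hw => ?_⟩
      rw [add_smul, smul_add]
      exact L.add_mem (monomialX_mono (le_max_left k l) hk w hw)
        (monomialX_mono (le_max_right k l) hl w hw)
    | hmul a b ha hb =>
      intro m hm
      have := ha (hb hm)
      rwa [smul_smul] at this

lemma mem_torsionModulo {L : Submodule (Weyl K ι) M} {m : M} :
    m ∈ torsionModulo L ↔ ∃ k : ℕ, ∀ w : List ι, w.length = k → monomialX K w • m ∈ L := Iff.rfl

variable (K ι M) in
/-- The torsion submodule `τ(M) = {m | ∃ k, Jᵏ m = 0}`. -/
def torsionSubmodule : Submodule (Weyl K ι) M := torsionModulo ⊥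

variable (K ι M) in
/-- `M` is a torsion module if `τ(M) = M`. -/
def IsTorsion : Prop := torsionSubmodule K ι M = ⊤

lemma le_torsionModulo (L : Submodule (Weyl K ι) M) : L ≤ torsionModulo L :=
  fun _ hm => ⟨0, fun _ _ => L.smul_mem _ hm⟩

lemma torsionModulo_mono {L L' : Submodule (Weyl K ι) M} (h : L ≤ L') :
    torsionModulo L ≤ torsionModulo L' :=
  fun _ ⟨k, hk⟩ => ⟨k, fun w hw => h (hk w hw)⟩

lemma torsionModulo_idem (L : Submodule (Weyl K ι) M) :
    torsionModulo (torsionModulo L) = torsionModulo L := by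
  refine le_antisymm ?_ (le_torsionModulo _)
  rintro m ⟨k, hk⟩
  have hk' : ∀ w : List ι, w.length = k →
      ∃ l : ℕ, ∀ v : List ι, v.length = l → monomialX K v • (monomialX K w • m) ∈ L := hk
  choose! l hl using hk'
  obtain ⟨B, hB⟩ := ((List.finite_length_eq ι k).image l).bddAbove
  refine ⟨B + k, fun w hw => ?_⟩
  rw [← List.take_append_drop B w, monomialX_append, mul_smul]
  have h1 : (w.drop B).length = k := by rw [List.length_drop]; omega
  have h2 : l (w.drop B) ≤ B := hB ⟨_, h1, rfl⟩
  exact monomialX_mono h2 (hl _ h1) _ (by rw [List.length_take]; omega)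

lemma map_mem_torsionModulo (f : M →ₗ[Weyl K ι] N) {L : Submodule (Weyl K ι) M}
    {L' : Submodule (Weyl K ι) N} (h : ∀ m ∈ L, f m ∈ L') {m : M} (hm : m ∈ torsionModulo L) :
    f m ∈ torsionModulo L' := by
  obtain ⟨k, hk⟩ := hm
  exact ⟨k, fun w hw => by rw [← map_smul]; exact h _ (hk w hw)⟩

lemma mem_torsionModulo_of_map (f : M →ₗ[Weyl K ι] N) {L : Submodule (Weyl K ι) M}
    {L' : Submodule (Weyl K ι) N} (h : ∀ m, f m ∈ L' → m ∈ L) {m : M}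
    (hm : f m ∈ torsionModulo L') : m ∈ torsionModulo L := by
  obtain ⟨k, hk⟩ := hm
  exact ⟨k, fun w hw => h _ (by rw [map_smul]; exact hk w hw)⟩

lemma isTorsion_ker_iff (f : M →ₗ[Weyl K ι] N) :
    IsTorsion K ι (LinearMap.ker f) ↔ ∀ m, f m = 0 → m ∈ torsionSubmodule K ι M := by
  constructor
  · intro h m hm
    have h1 : (⟨m, hm⟩ : LinearMap.ker f) ∈ torsionSubmodule K ι (LinearMap.ker f) := by
      rw [h]; trivial
    exact map_mem_torsionModulo (LinearMap.ker f).subtype (by simp) h1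
  · intro h
    refine eq_top_iff.2 fun m _ => ?_
    exact mem_torsionModulo_of_map (LinearMap.ker f).subtype (L' := ⊥) (by simp) (h m.1 m.2)

lemma isTorsion_quotient_iff (L : Submodule (Weyl K ι) N) :
    IsTorsion K ι (N ⧸ L) ↔ torsionModulo L = ⊤ := by
  constructor
  · intro h
    refine eq_top_iff.2 fun m _ => ?_
    have h1 : L.mkQ m ∈ torsionSubmodule K ι (N ⧸ L) := by rw [h]; trivial
    exact mem_torsionModulo_of_map L.mkQ (L' := ⊥) (by simp) h1
  · intro h
    refine eq_top_iff.2 fun m _ => ?_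
    obtain ⟨m, rfl⟩ := L.mkQ_surjective m
    have h1 : m ∈ torsionModulo L := by rw [h]; trivial
    exact map_mem_torsionModulo L.mkQ (by simp) h1

end Torsion

/-! ## Saturation: every `λ`-Euler module has a torsion-free saturated envelope

The facts in this section serve only to construct the section functor below. -/

lemma exists_essential_retract {R : Type u} [Ring R] {I : Type u} [AddCommGroup I] [Module R I]
    [Module.Injective R I] (N : Submodule R I) :
    ∃ (E : Submodule R I) (r : I →ₗ[R] I), N ≤ E ∧
      (∀ y ∈ E, y ≠ 0 → ∃ a : R, a • y ∈ N ∧ a • y ≠ 0) ∧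
      (∀ y, r y ∈ E) ∧ ∀ y ∈ E, r y = y := by
  obtain ⟨E, hNE, hE⟩ := zorn_le_nonempty₀
    {E : Submodule R I | N ≤ E ∧ ∀ y ∈ E, y ≠ 0 → ∃ a : R, a • y ∈ N ∧ a • y ≠ 0} (by
      intro c hc hchain F hF
      refine ⟨sSup c, ⟨(hc hF).1.trans (le_sSup hF), fun y hy hy0 => ?_⟩, fun _ h => le_sSup h⟩
      obtain ⟨G, hG, hyG⟩ := (Submodule.mem_sSup_of_directed ⟨F, hF⟩ hchain.directedOn).1 hy
      exact (hc hG).2 y hyG hy0) N ⟨le_rfl, fun y hy hy0 => ⟨1, by simpa using hy, by simpa⟩⟩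
  obtain ⟨C, -, hC⟩ := zorn_le_nonempty₀
    {C : Submodule R I | ∀ y ∈ C, y ∈ E → y = 0} (by
      intro c hc hchain F hF
      refine ⟨sSup c, fun y hy hyE => ?_, fun _ h => le_sSup h⟩
      obtain ⟨G, hG, hyG⟩ := (Submodule.mem_sSup_of_directed ⟨F, hF⟩ hchain.directedOn).1 hy
      exact hc hG y hyG hyE) ⊥ (fun y hy _ => by simpa using hy)
  have hinj : Function.Injective (C.mkQ ∘ₗ E.subtype) := by
    rw [← LinearMap.ker_eq_bot, LinearMap.ker_eq_bot']
    intro e he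
    have he' : (e : I) ∈ C := by simpa using he
    exact Subtype.ext (hC.prop _ he' e.2)
  obtain ⟨φ, hφ⟩ := Module.Injective.out (C.mkQ ∘ₗ E.subtype) hinj E.subtype
  have hφE : ∀ e ∈ E, φ (C.mkQ e) = e := fun e he => hφ ⟨e, he⟩
  have key : ∀ y, C.mkQ y ≠ 0 → ∃ a : R, a • φ (C.mkQ y) ∈ E ∧ a • φ (C.mkQ y) ≠ 0 := by
    intro y hy
    have hyC : y ∉ C := by simpa using hy
    have hnot : ¬ ∀ z ∈ C ⊔ R ∙ y, z ∈ E → z = 0 := by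
      intro h
      exact hyC (hC.le_of_ge h le_sup_left
        (Submodule.mem_sup_right (Submodule.mem_span_singleton_self y)))
    push Not at hnot
    obtain ⟨z, hz, hzE, hz0⟩ := hnot
    obtain ⟨c, hc, v, hv, rfl⟩ := Submodule.mem_sup.1 hz
    obtain ⟨a, rfl⟩ := Submodule.mem_span_singleton.1 hv
    have h1 : a • φ (C.mkQ y) = c + a • y := by
      rw [← map_smul, ← map_smul, ← hφE _ hzE, map_add]
      have : C.mkQ c = 0 := by simpa using hc
      rw [this, zero_add]
    exact ⟨a, by rw [h1]; exact hzE, by rw [h1]; exact hz0⟩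
  refine ⟨E, φ ∘ₗ C.mkQ, hNE, hE.prop.2, ?_, hφE⟩
  have hle : E ≤ LinearMap.range (φ ∘ₗ C.mkQ) := fun e he => ⟨e, hφE e he⟩
  have hge := hE.le_of_ge (y := LinearMap.range (φ ∘ₗ C.mkQ)) ⟨hNE.trans hle, by
    rintro _ ⟨y, rfl⟩ hy0
    have hy : C.mkQ y ≠ 0 := by
      intro h
      apply hy0
      rw [LinearMap.comp_apply, h, map_zero]
    obtain ⟨a, ha, ha0⟩ := key y hy
    obtain ⟨b, hb, hb0⟩ := hE.prop.2 _ ha ha0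
    exact ⟨b * a, by rw [mul_smul]; exact hb, by rw [mul_smul]; exact hb0⟩⟩ hle
  exact fun y => hge ⟨y, rfl⟩

section Saturation

variable {M : Type u} [AddCommGroup M] [Module (Weyl K ι) M]

/-- The `λ`-Euler part of a submodule `P`: the sum of the `E`-eigenspaces of `P` for the
eigenvalues `λ + k`, `k ∈ ℤ`. -/
def eulerPart (d : ι → ℕ) (lam : K) (P : Submodule (Weyl K ι) M) : Submodule (Weyl K ι) M where
  __ := AddSubgroup.closure {m | m ∈ P ∧ ∃ k : ℤ, m ∈ weightSpace d (lam + k) M}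
  smul_mem' := by
    have hgen : ∀ (s : ι ⊕ ι) (m : M),
        m ∈ AddSubgroup.closure {m | m ∈ P ∧ ∃ k : ℤ, m ∈ weightSpace d (lam + k) M} →
        gen K s • m ∈
          AddSubgroup.closure {m | m ∈ P ∧ ∃ k : ℤ, m ∈ weightSpace d (lam + k) M} := by
      intro s m hm
      induction hm using AddSubgroup.closure_induction with
      | mem m hm =>
        obtain ⟨hP, k, hk⟩ := hm
        refine AddSubgroup.subset_closure ⟨P.smul_mem _ hP, k + genDegree d s, ?_⟩
        have := smul_mem_weightSpace d (k := genDegree d s) (a := gen K s)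
          (Submodule.subset_span ⟨[s], by simp, by simp⟩) hk
        simpa [add_assoc] using this
      | zero => rw [smul_zero]; exact zero_mem _
      | add a b _ _ ha hb => rw [smul_add]; exact add_mem ha hb
      | neg a _ ha => rw [smul_neg]; exact neg_mem ha
    intro a
    induction a using weyl_induction with
    | h0 c =>
      intro m hm
      change m ∈ AddSubgroup.closure _ at hm
      change _ ∈ AddSubgroup.closure _
      induction hm using AddSubgroup.closure_induction with
      | mem m hm =>
        obtain ⟨hP, k, hk⟩ := hm
        refine AddSubgroup.subset_closure ⟨P.smul_mem _ hP, k, ?_⟩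
        change euler K d • m = _ at hk
        change euler K d • (_ • m) = _
        rw [smul_smul, ← Algebra.commutes, mul_smul, hk, smul_smul, smul_smul, Algebra.commutes]
      | zero => rw [smul_zero]; exact zero_mem _
      | add a b _ _ ha hb => rw [smul_add]; exact add_mem ha hb
      | neg a _ ha => rw [smul_neg]; exact neg_mem ha
    | hx i => exact fun {m} hm => hgen (Sum.inl i) m hm
    | hd i => exact fun {m} hm => hgen (Sum.inr i) m hm
    | hadd a b ha hb =>
      intro m hm
      rw [add_smul]
      exact add_mem (S := AddSubgroup M) (ha hm) (hb hm)
    | hmul a b ha hb =>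
      intro m hm
      rw [mul_smul]
      exact ha (hb hm)

lemma eulerPart_le (d : ι → ℕ) (lam : K) (P : Submodule (Weyl K ι) M) :
    eulerPart d lam P ≤ P :=
  fun _ hm => (AddSubgroup.closure_le P.toAddSubgroup).2 (fun _ h => h.1) hm

lemma isEuler_eulerPart (d : ι → ℕ) (lam : K) (P : Submodule (Weyl K ι) M) :
    IsEuler d lam (eulerPart d lam P) := by
  refine eq_top_iff.2 ?_
  have h : ∀ m (hm : m ∈ AddSubgroup.closure
      {m | m ∈ P ∧ ∃ k : ℤ, m ∈ weightSpace d (lam + k) M}),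
      (⟨m, hm⟩ : eulerPart d lam P) ∈ ⨆ k : ℤ, weightSpace d (lam + k) (eulerPart d lam P) := by
    intro m hm
    induction hm using AddSubgroup.closure_induction with
    | mem m hm =>
      obtain ⟨hP, k, hk⟩ := hm
      exact AddSubgroup.mem_iSup_of_mem k (Subtype.ext hk)
    | zero => exact zero_mem _
    | add a b _ _ ha hb => exact add_mem ha hb
    | neg a _ ha => exact neg_mem ha
  exact fun m _ => h m.1 m.2

lemma map_mem_eulerPart (d : ι → ℕ) (lam : K) {N : Type u} [AddCommGroup N] [Module (Weyl K ι) N]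
    (hN : IsEuler d lam N) (P : Submodule (Weyl K ι) M) (f : N →ₗ[Weyl K ι] M)
    (hf : ∀ n, f n ∈ P) (n : N) : f n ∈ eulerPart d lam P := by
  have hn : n ∈ ⨆ k : ℤ, weightSpace d (lam + k) N := by rw [hN]; trivial
  refine AddSubgroup.iSup_induction (fun k : ℤ => weightSpace d (lam + k) N)
    (C := fun n => f n ∈ eulerPart d lam P) hn ?_ ?_ ?_
  · exact fun k n hn => AddSubgroup.subset_closure ⟨hf n, k, map_mem_weightSpace d f hn⟩
  · rw [map_zero]; exact zero_mem _
  · intro a b ha hb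
    rw [map_add]; exact add_mem ha hb

/-- Existence of saturations. -/
lemma exists_saturation (d : ι → ℕ) (lam : K) (hM : IsEuler d lam M) :
    ∃ (S : ModuleCat.{u} (Weyl K ι)) (g : M →ₗ[Weyl K ι] S), IsEuler d lam S ∧
      IsTorsion K ι (LinearMap.ker g) ∧ IsTorsion K ι (S ⧸ LinearMap.range g) ∧
      ∀ (N N' : Type u) [AddCommGroup N] [Module (Weyl K ι) N] [AddCommGroup N']
        [Module (Weyl K ι) N'] (f : N →ₗ[Weyl K ι] N'), IsEuler d lam N' →
        IsTorsion K ι (LinearMap.ker f) → IsTorsion K ι (N' ⧸ LinearMap.range f) →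
        Function.Bijective (fun h : N' →ₗ[Weyl K ι] S => h ∘ₗ f) := by
  -- an injective module containing `M / τ(M)`
  obtain ⟨⟨I, hI, β, hβ⟩⟩ := (ModuleCat.enoughInjectives.{u} (R := Weyl K ι)).presentation
    (ModuleCat.of (Weyl K ι) (M ⧸ torsionSubmodule K ι M))
  have : Module.Injective (Weyl K ι) I := Module.injective_module_of_injective_object _ _
  have hβ' : Function.Injective β.hom := (ModuleCat.mono_iff_injective β).1 hβ
  let α : M →ₗ[Weyl K ι] I := β.hom ∘ₗ (torsionSubmodule K ι M).mkQ
  have hα : ∀ m, α m = 0 ↔ m ∈ torsionSubmodule K ι M := by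
    intro m
    change β.hom _ = 0 ↔ _
    rw [map_eq_zero_iff _ hβ']
    simp
  obtain ⟨E, r, hNE, hess, hrE, hrid⟩ := exists_essential_retract (LinearMap.range α)
  let P := E ⊓ torsionModulo (LinearMap.range α)
  -- `E` is torsion-free
  have hfree : ∀ y ∈ E, y ∈ torsionSubmodule K ι I → y = 0 := by
    intro y hy hyt
    by_contra hy0
    obtain ⟨a, ⟨m, hm⟩, ha0⟩ := hess y hy hy0
    have h1 : α m ∈ torsionSubmodule K ι I := by
      rw [hm]; exact Submodule.smul_mem _ _ hyt
    have h2 : m ∈ torsionModulo (torsionSubmodule K ι M) :=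
      mem_torsionModulo_of_map α (L' := ⊥) (fun m hm => (hα m).1 (by simpa using hm)) h1
    rw [torsionSubmodule, torsionModulo_idem] at h2
    exact ha0 (by rw [← hm]; exact (hα m).2 h2)
  have hαP : ∀ m, α m ∈ P := fun m => ⟨hNE ⟨m, rfl⟩, le_torsionModulo _ ⟨m, rfl⟩⟩
  let g : M →ₗ[Weyl K ι] eulerPart d lam P :=
    α.codRestrict _ (map_mem_eulerPart d lam hM P α hαP)
  have hSfree : ∀ s : eulerPart d lam P, s ∈ torsionSubmodule K ι (eulerPart d lam P) → s = 0 := by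
    intro s hs
    refine Subtype.ext (hfree s (eulerPart_le d lam P s.2).1 ?_)
    exact map_mem_torsionModulo (eulerPart d lam P).subtype (by simp) hs
  refine ⟨ModuleCat.of _ (eulerPart d lam P), g, isEuler_eulerPart d lam P, ?_, ?_, ?_⟩
  · rw [isTorsion_ker_iff]
    intro m hm
    exact (hα m).1 (congrArg Subtype.val hm)
  · rw [isTorsion_quotient_iff]
    refine eq_top_iff.2 fun s _ => ?_
    refine mem_torsionModulo_of_map (eulerPart d lam P).subtype (L' := LinearMap.range α) ?_
      (eulerPart_le d lam P s.2).2
    rintro s ⟨m, hm⟩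
    exact ⟨m, Subtype.ext hm⟩
  · intro N N' _ _ _ _ f hN' hker hcoker
    rw [isTorsion_ker_iff] at hker
    rw [isTorsion_quotient_iff] at hcoker
    constructor
    · intro h₁ h₂ h12
      refine sub_eq_zero.1 (LinearMap.ext fun n' => hSfree _ ?_)
      have hn' : n' ∈ torsionModulo (LinearMap.range f) := by rw [hcoker]; trivial
      refine map_mem_torsionModulo (h₁ - h₂) ?_ hn'
      rintro _ ⟨n, rfl⟩
      have := LinearMap.congr_fun h12 n
      simpa [sub_eq_zero] using this
    · intro h
      let h' : N →ₗ[Weyl K ι] I := (eulerPart d lam P).subtype ∘ₗ h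
      have hk : LinearMap.ker f ≤ LinearMap.ker h' := by
        intro n hn
        have h1 : h n = 0 := hSfree _ (map_mem_torsionModulo h (by simp) (hker n hn))
        simp [h', h1]
      let h'' : LinearMap.range f →ₗ[Weyl K ι] I :=
        (LinearMap.ker f).liftQ h' hk ∘ₗ f.quotKerEquivRange.symm.toLinearMap
      have hh'' : ∀ n, h'' ⟨f n, ⟨n, rfl⟩⟩ = h n := by
        intro n
        have : f.quotKerEquivRange.symm ⟨f n, ⟨n, rfl⟩⟩ = (LinearMap.ker f).mkQ n :=
          f.quotKerEquivRange_symm_apply_image n ⟨n, rfl⟩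
        simp only [h'', LinearMap.comp_apply, LinearEquiv.coe_coe, this]
        simp [h']
      obtain ⟨H, hH⟩ := Module.Injective.out (LinearMap.range f).subtype
        (Submodule.subtype_injective _) h''
      have hHf : ∀ n, r (H (f n)) = h n := by
        intro n
        have := hH ⟨f n, ⟨n, rfl⟩⟩
        rw [hh''] at this
        change H (f n) = _ at this
        rw [this]
        exact hrid _ (eulerPart_le d lam P (h n).2).1
      have hP : ∀ n', (r ∘ₗ H) n' ∈ P := by
        intro n'
        refine ⟨hrE _, ?_⟩
        rw [← torsionModulo_idem]
        have hn' : n' ∈ torsionModulo (LinearMap.range f) := by rw [hcoker]; trivial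
        refine map_mem_torsionModulo (r ∘ₗ H) ?_ hn'
        rintro _ ⟨n, rfl⟩
        rw [LinearMap.comp_apply, hHf]
        exact (eulerPart_le d lam P (h n).2).2
      refine ⟨(r ∘ₗ H).codRestrict _ (map_mem_eulerPart d lam hN' P _ hP), ?_⟩
      refine LinearMap.ext fun n => Subtype.ext ?_
      exact hHf n

end Saturation

/-! ## The category of `λ`-twisted D-modules on `[P(V)]` and the global sections functor -/

/-- The category `𝐃-Gr^λ` of `λ`-Euler modules, with its canonical grading `Mₖ = M^{λ+k}`; all
`𝐃`-linear maps between such modules preserve this grading. -/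
abbrev EulerMod (d : ι → ℕ) (lam : K) :=
  ObjectProperty.FullSubcategory
    (fun M : ModuleCat.{u} (Weyl K ι) => IsEuler d lam M)

/-- The underlying linear map of a morphism of `λ`-Euler modules. -/
abbrev EulerMod.lin {d : ι → ℕ} {lam : K} {M N : EulerMod d lam} (f : M ⟶ N) :
    M.obj →ₗ[Weyl K ι] N.obj := f.hom.hom

/-- The morphisms of `λ`-Euler modules whose kernel and cokernel are torsion. -/
def torsionIso (d : ι → ℕ) (lam : K) : MorphismProperty (EulerMod d lam) := fun _ N f =>
  IsTorsion K ι (LinearMap.ker (EulerMod.lin f)) ∧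
    IsTorsion K ι (N.obj ⧸ LinearMap.range (EulerMod.lin f))

/-- The category of quasicoherent `λ`-twisted D-modules on the weighted projective stack: the
quotient category `𝐃-Gr^λ / 𝐃-Tors^λ`, that is, the localization of `𝐃-Gr^λ` at the morphisms
with torsion kernel and cokernel. -/
abbrev TwistedDMod (d : ι → ℕ) (lam : K) := (torsionIso d lam).Localization

/-- The quotient functor `π`. -/
abbrev quotientFunctor (d : ι → ℕ) (lam : K) : EulerMod d lam ⥤ TwistedDMod d lam :=
  (torsionIso d lam).Q

lemma exists_saturation_hom (d : ι → ℕ) (lam : K) (M : EulerMod d lam) :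
    ∃ (S : EulerMod d lam) (g : M ⟶ S), torsionIso d lam g ∧ (torsionIso d lam).isLocal S := by
  obtain ⟨S, g, hS, hker, hcoker, hloc⟩ := exists_saturation d lam M.property
  refine ⟨⟨S, hS⟩, ObjectProperty.homMk (ModuleCat.ofHom g), ⟨hker, hcoker⟩, ?_⟩
  intro N N' f hf
  have := hloc N.obj N'.obj (EulerMod.lin f) N'.property hf.1 hf.2
  constructor
  · intro a b hab
    apply ObjectProperty.hom_ext
    apply ModuleCat.hom_ext
    exact this.1 (congrArg EulerMod.lin hab)
  · intro b
    obtain ⟨a, ha⟩ := this.2 (EulerMod.lin b)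
    refine ⟨ObjectProperty.homMk (ModuleCat.ofHom a), ?_⟩
    apply ObjectProperty.hom_ext
    apply ModuleCat.hom_ext
    exact ha

lemma torsionIso_of_isLocal (d : ι → ℕ) (lam : K) {X Y : EulerMod d lam} (f : X ⟶ Y)
    (hf : (torsionIso d lam).isLocal.isLocal f) : torsionIso d lam f := by
  obtain ⟨SX, gX, hgX, hSX⟩ := exists_saturation_hom d lam X
  obtain ⟨SY, gY, hgY, hSY⟩ := exists_saturation_hom d lam Y
  obtain ⟨h, hh⟩ := (hSY gX hgX).2 (f ≫ gY)
  replace hh : gX ≫ h = f ≫ gY := hh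
  have hgX' := MorphismProperty.le_isLocal_isLocal (torsionIso d lam) _ hgX
  have hgY' := MorphismProperty.le_isLocal_isLocal (torsionIso d lam) _ hgY
  have hcomp : (torsionIso d lam).isLocal.isLocal (gX ≫ h) := by
    rw [hh]; exact MorphismProperty.comp_mem _ _ _ hf hgY'
  have hh' := MorphismProperty.of_precomp _ _ _ hgX' hcomp
  rw [ObjectProperty.isLocal_iff_isIso _ _ hSX hSY] at hh'
  have e : ∀ m, EulerMod.lin h (EulerMod.lin gX m) = EulerMod.lin gY (EulerMod.lin f m) :=
    fun m => LinearMap.congr_fun (congrArg EulerMod.lin hh) m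
  have einv : ∀ s, EulerMod.lin (inv h) (EulerMod.lin h s) = s :=
    fun s => LinearMap.congr_fun (congrArg EulerMod.lin (IsIso.hom_inv_id h)) s
  have einv' : ∀ s, EulerMod.lin h (EulerMod.lin (inv h) s) = s :=
    fun s => LinearMap.congr_fun (congrArg EulerMod.lin (IsIso.inv_hom_id h)) s
  obtain ⟨hX1, hX2⟩ := hgX
  obtain ⟨hY1, -⟩ := hgY
  rw [isTorsion_ker_iff] at hX1 hY1
  rw [isTorsion_quotient_iff] at hX2
  refine ⟨?_, ?_⟩
  · rw [isTorsion_ker_iff]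
    intro m hm
    refine hX1 m ?_
    rw [← einv (EulerMod.lin gX m), e, hm, map_zero, map_zero]
  · rw [isTorsion_quotient_iff]
    refine eq_top_iff.2 fun y _ => ?_
    have h1 : EulerMod.lin (inv h) (EulerMod.lin gY y) ∈
        torsionModulo (LinearMap.range (EulerMod.lin gX)) := by rw [hX2]; trivial
    rw [← torsionModulo_idem]
    refine mem_torsionModulo_of_map (EulerMod.lin (inv h) ∘ₗ EulerMod.lin gY) ?_ h1
    rintro z ⟨m, hm⟩
    have h2 : EulerMod.lin gY (z - EulerMod.lin f m) = 0 := by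
      rw [map_sub, ← e, hm, LinearMap.comp_apply, einv', sub_self]
    have h3 : z - EulerMod.lin f m ∈ torsionModulo (LinearMap.range (EulerMod.lin f)) :=
      torsionModulo_mono bot_le (hY1 _ h2)
    have h4 := add_mem h3 (le_torsionModulo _ ⟨m, rfl⟩ :
      EulerMod.lin f m ∈ torsionModulo (LinearMap.range (EulerMod.lin f)))
    rwa [sub_add_cancel] at h4

/-- The saturated modules form a reflective subcategory. -/
lemma isRightAdjoint_ι (d : ι → ℕ) (lam : K) : (torsionIso d lam).isLocal.ι.IsRightAdjoint := by
  have : ∀ A, Limits.HasInitial (StructuredArrow A (torsionIso d lam).isLocal.ι) := by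
    intro A
    obtain ⟨S, g, hg, hS⟩ := exists_saturation_hom d lam A
    let Z : StructuredArrow A (torsionIso d lam).isLocal.ι :=
      StructuredArrow.mk (Y := (⟨S, hS⟩ : (torsionIso d lam).isLocal.FullSubcategory)) g
    have hex : ∀ Y : StructuredArrow A (torsionIso d lam).isLocal.ι, Nonempty (Unique (Z ⟶ Y)) := by
      intro Y
      obtain ⟨h, hh⟩ := (Y.right.property g hg).2 Y.hom
      refine ⟨⟨⟨StructuredArrow.homMk (ObjectProperty.homMk h) hh⟩, fun a => ?_⟩⟩
      apply StructuredArrow.ext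
      apply ObjectProperty.hom_ext
      apply (Y.right.property g hg).1
      exact (StructuredArrow.w a).trans hh.symm
    have := fun Y => (hex Y).some
    exact Limits.hasInitial_of_unique Z
  exact isRightAdjointOfStructuredArrowInitials _

/-- The quotient functor has a right adjoint. -/
instance (d : ι → ℕ) (lam : K) : (quotientFunctor d lam).IsLeftAdjoint := by
  have := isRightAdjoint_ι d lam
  let F := (torsionIso d lam).isLocal.ι
  let adj := Adjunction.ofIsRightAdjoint F
  have hW : torsionIso d lam = ObjectProperty.isLocal (· ∈ Set.range F.obj) := by
    have hr : (· ∈ Set.range F.obj : ObjectProperty (EulerMod d lam)) =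
        (torsionIso d lam).isLocal := by
      ext X
      exact ⟨fun ⟨Y, hY⟩ => hY ▸ Y.property, fun h => ⟨⟨X, h⟩, rfl⟩⟩
    rw [hr]
    exact le_antisymm (MorphismProperty.le_isLocal_isLocal _)
      fun _ _ f hf => torsionIso_of_isLocal d lam f hf
  have hloc : ∀ W, W = ObjectProperty.isLocal (· ∈ Set.range F.obj) →
      F.leftAdjoint.IsLocalization W := by
    rintro _ rfl
    exact ObjectProperty.isLocalization_isLocal adj
  have := hloc _ hW
  let e := Localization.compUniqFunctor F.leftAdjoint (quotientFunctor d lam) (torsionIso d lam)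
  have h := (adj.comp (Localization.uniq F.leftAdjoint (quotientFunctor d lam)
    (torsionIso d lam)).toAdjunction).ofNatIsoLeft e
  exact h.isLeftAdjoint

/-- The section functor `ω`, right adjoint to the quotient functor `π`. -/
def sectionFunctor (d : ι → ℕ) (lam : K) : TwistedDMod d lam ⥤ EulerMod d lam :=
  (quotientFunctor d lam).rightAdjoint

/-- The adjunction `π ⊣ ω`. -/
def sectionAdjunction (d : ι → ℕ) (lam : K) :
    quotientFunctor d lam ⊣ sectionFunctor d lam :=
  Adjunction.ofIsLeftAdjoint _

/-- The functor `M ↦ M₀ = M^λ` from `λ`-Euler modules to modules over `𝐃₀ / 𝐃₀ (E - λ)`. -/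
def degreeZeroFunctor (d : ι → ℕ) (lam : K) :
    EulerMod d lam ⥤ ModuleCat.{u} (TwistedOps d lam) where
  obj M := ModuleCat.of _ (weightSpace d lam M.obj)
  map {M N} f := ModuleCat.ofHom
    { toFun := fun m => ⟨EulerMod.lin f m, map_mem_weightSpace d (EulerMod.lin f) m.2⟩
      map_add' := fun a b => Subtype.ext (map_add (EulerMod.lin f) (a : M.obj) (b : M.obj))
      map_smul' := fun a m => by
        obtain ⟨a, rfl⟩ := Ideal.Quotient.mk_surjective a
        exact Subtype.ext (map_smul (EulerMod.lin f) (a : Weyl K ι) (m : M.obj)) }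

/-- The global sections functor `Γ_λ(ℳ) = ω(ℳ)₀`. -/
def globalSections (d : ι → ℕ) (lam : K) :
    TwistedDMod d lam ⥤ ModuleCat.{u} (TwistedOps d lam) :=
  sectionFunctor d lam ⋙ degreeZeroFunctor d lam

/-- The kernel of `Γ_λ`: the twisted D-modules `ℳ` with `Γ_λ(ℳ) = 0`. -/
def kernelGlobalSections (d : ι → ℕ) (lam : K) : ObjectProperty (TwistedDMod d lam) :=
  fun ℳ => Limits.IsZero ((globalSections d lam).obj ℳ)

end Main
end WeightedDMod

end

/-!
`ω(ℳ)` has no torsion weight vectors, and `Γ_λ(ℳ)` is its part of weight `λ`.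

Suppose `gcd(d₀, …, dₙ) = 1` and `ω(ℳ) ≠ 0`. Among the sets `R` of generators `xᵢ, ∂ᵢ` whose
elements all act locally nilpotently on some nonzero weight vector of `ω(ℳ)`, take a maximal one,
and let `N` be the submodule of vectors on which all of `R` acts locally nilpotently. A generator
outside `R` kills no nonzero weight vector of `N`, so the degrees in which `N` is nonzero are
stable under adding the degree of that generator. Since `[∂ᵢ, xᵢ] = 1` in characteristic zero, `R`
never contains both `xᵢ` and `∂ᵢ`; since there is no torsion, some `xᵢ` is outside `R`. If some
`∂ⱼ` is outside `R` as well, there are shifts of both signs, and the `dᵢ` being coprime the shifts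
form all of `ℤ`, so degree `0` occurs. If all `∂ⱼ` are in `R`, then `N` contains a weight vector
killed by every `∂ⱼ`, whose weight is `0`; hence `λ` is an integer, so `λ ∈ 𝒜` by hypothesis, and
multiplying by the `xᵢ`, all of which are outside `R`, leads from degree `-λ` to degree `0`.

If `g = gcd(d₀, …, dₙ) > 1`, choose `α` with `∑ dᵢ αᵢ = λ + 1`. The twisted Laurent polynomials
`x^α K[x^±1]` are torsion-free with weights in `λ + 1 + gℤ`, and a vector of weight `λ` in the
saturation would be carried into them by monomials in the `xᵢ`, which change weights by multiples
of `g`.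
-/

namespace WeightedDMod

section Arithmetic

lemma neg_mem_of_mul_neg {A : AddSubmonoid ℤ} {a b : ℤ} (ha : a ∈ A) (hb : b ∈ A)
    (hab : a * b < 0) : -a ∈ A := by
  have hb0 : b ≠ 0 := right_ne_zero_of_mul hab.ne
  have hcomb : -a = (b.natAbs - 1) • a + a.natAbs • b := by
    rw [nsmul_eq_mul, nsmul_eq_mul, Nat.cast_pred (Int.natAbs_pos.2 hb0)]
    rcases mul_neg_iff.1 hab with ⟨ha, hb⟩ | ⟨ha, hb⟩
    · rw [Int.natCast_natAbs, Int.natCast_natAbs, abs_of_pos ha, abs_of_neg hb]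
      ring
    · rw [Int.natCast_natAbs, Int.natCast_natAbs, abs_of_neg ha, abs_of_pos hb]
      ring
  exact hcomb ▸ add_mem (nsmul_mem ha _) (nsmul_mem hb _)

lemma addSubgroup_eq_top_of_gcd_eq_one {ι : Type*} {s : Finset ι} {d : ι → ℕ}
    (hgcd : s.gcd d = 1) {H : AddSubgroup ℤ} (hd : ∀ i ∈ s, (d i : ℤ) ∈ H) : H = ⊤ := by
  obtain ⟨g, rfl⟩ := Int.subgroup_cyclic H
  simp only [← AddSubgroup.zmultiples_eq_closure, Int.mem_zmultiples_iff] at hd ⊢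
  have hg : g.natAbs ∣ s.gcd d := Finset.dvd_gcd fun i hi => Int.natAbs_dvd_natAbs.2 (hd i hi)
  rw [hgcd, Nat.dvd_one, ← Int.isUnit_iff_natAbs_eq] at hg
  exact eq_top_iff.2 fun c _ => Int.mem_zmultiples_iff.2 hg.dvd

lemma addSubmonoid_eq_top_of_gcd_eq_one {ι : Type*} {s : Finset ι} {d : ι → ℕ}
    (hgcd : s.gcd d = 1) {A : AddSubmonoid ℤ} (hd : ∀ i ∈ s, (d i : ℤ) ∈ A ∨ -(d i : ℤ) ∈ A)
    {a b : ℤ} (ha : a ∈ A) (ha0 : 0 < a) (hb : b ∈ A) (hb0 : b < 0) : A = ⊤ := by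
  have hneg {c : ℤ} (hc : c ∈ A) : -c ∈ A := by
    rcases lt_trichotomy c 0 with hc0 | rfl | hc0
    · exact neg_mem_of_mul_neg hc ha (mul_neg_of_neg_of_pos hc0 ha0)
    · simp
    · exact neg_mem_of_mul_neg hc hb (mul_neg_of_pos_of_neg hc0 hb0)
  let H : AddSubgroup ℤ := { A with neg_mem' := hneg }
  have hH : H = ⊤ := addSubgroup_eq_top_of_gcd_eq_one hgcd fun i hi =>
    (hd i hi).elim id fun h => neg_neg (d i : ℤ) ▸ hneg h
  exact congrArg AddSubgroup.toAddSubmonoid hH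

/-- The integers `a` such that the translate `P + a` is contained in `P`. -/
def shifts (P : Set ℤ) : AddSubmonoid ℤ where
  carrier := {a | ∀ k ∈ P, k + a ∈ P}
  zero_mem' k hk := (add_zero k).symm ▸ hk
  add_mem' {a b} ha hb k hk := add_assoc k a b ▸ hb _ (ha k hk)

lemma zero_mem_of_natCast_add_eq_zero {K : Type*} [Ring K] [CharZero K] {ι : Type*}
    {d : ι → ℕ} {lam : K} {P : Set ℤ} {k : ℤ} (hk : k ∈ P)
    (hlam : lam ∈ (Set.range (Int.cast : ℤ → K))ᶜ ∪
      (Nat.cast : ℕ → K) '' (AddSubmonoid.closure (Set.range d) : Set ℕ))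
    (hd : ∀ i, (d i : ℤ) ∈ shifts P) (hlk : lam + k = 0) : 0 ∈ P := by
  obtain hlam | ⟨a, ha, rfl⟩ := hlam
  · exact absurd ⟨-k, by rw [Int.cast_neg, neg_eq_of_add_eq_zero_left hlk]⟩ hlam
  have hclosure : AddSubmonoid.closure (Set.range d) ≤
      (shifts P).comap (Nat.castAddMonoidHom ℤ) :=
    AddSubmonoid.closure_le.2 (Set.range_subset_iff.2 hd)
  have hka : k + a = 0 := by rw [add_comm]; exact_mod_cast hlk
  exact hka ▸ hclosure ha k hk

lemma exists_sum_mul_eq {K : Type*} [Field K] [CharZero K] {ι : Type*} [Fintype ι] {d : ι → ℕ}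
    {j : ι} (hj : d j ≠ 0) (μ : K) : ∃ α : ι → K, ∑ i, d i * α i = μ := by
  classical
  refine ⟨Pi.single j (μ / d j), ?_⟩
  rw [Fintype.sum_eq_single j fun i hi => by rw [Pi.single_eq_of_ne hi, mul_zero],
    Pi.single_eq_same, mul_div_cancel₀ _ (Nat.cast_ne_zero.2 hj)]

end Arithmetic

section Nilpotent

lemma mul_pow_succ_of_mul_eq_add {A : Type*} [Semiring A] {a b c : A} (hac : Commute a c)
    (h : b * a = a * b + c) (k : ℕ) :
    b * a ^ (k + 1) = a ^ (k + 1) * b + (k + 1) • (c * a ^ k) := by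
  induction k with
  | zero => simp [h]
  | succ k ih =>
    calc b * a ^ (k + 1 + 1) = a * (b * a ^ (k + 1)) + c * a ^ (k + 1) := by
          rw [pow_succ' a (k + 1), ← mul_assoc, h, add_mul, mul_assoc]
      _ = a ^ (k + 1 + 1) * b + (k + 1) • (c * a ^ (k + 1)) + c * a ^ (k + 1) := by
          rw [ih, mul_add, ← mul_assoc, ← pow_succ', mul_smul_comm, ← mul_assoc, hac.eq,
            mul_assoc c, ← pow_succ']
      _ = a ^ (k + 1 + 1) * b + (k + 1 + 1) • (c * a ^ (k + 1)) := by rw [add_assoc, ← succ_nsmul]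

lemma exists_pow_smul_ne_zero {A M : Type*} [Monoid A] [Zero M] [MulAction A M] {a : A} {m : M}
    (hm : m ≠ 0) (h : ∃ k : ℕ, a ^ k • m = 0) : ∃ k : ℕ, a ^ k • m ≠ 0 ∧ a ^ (k + 1) • m = 0 := by
  by_contra! hstep
  obtain ⟨k, hk⟩ := h
  have hpow (l : ℕ) : a ^ l • m ≠ 0 := by
    induction l with
    | zero => simpa using hm
    | succ l ih => exact hstep l ih
  exact hpow k hk

lemma exists_pow_smul_add_eq_zero {A M : Type*} [Monoid A] [AddMonoid M] [DistribMulAction A M]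
    {a : A} {m n : M} (hm : ∃ k : ℕ, a ^ k • m = 0) (hn : ∃ k : ℕ, a ^ k • n = 0) :
    ∃ k : ℕ, a ^ k • (m + n) = 0 := by
  obtain ⟨k, hk⟩ := hm
  obtain ⟨l, hl⟩ := hn
  refine ⟨k + l, ?_⟩
  rw [smul_add, add_comm k, pow_add, mul_smul _ _ m, hk, (Commute.pow_pow_self a l k).eq, mul_smul,
    hl, smul_zero, smul_zero, add_zero]

variable {K : Type u} [Field K] {ι : Type} [DecidableEq ι]

lemma exists_gen_mul_gen (s t : ι ⊕ ι) :
    ∃ c : K, gen K s * gen K t = gen K t * gen K s + algebraMap K (Weyl K ι) c := by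
  rcases s with i | i <;> rcases t with j | j
  · exact ⟨0, by rw [map_zero, add_zero]; exact x_mul_x K i j⟩
  · exact ⟨-(if j = i then 1 else 0), by
      rw [map_neg, ← sub_eq_add_neg, eq_sub_iff_add_eq, apply_ite (algebraMap K _), map_one,
        map_zero]
      exact (del_mul_x K j i).symm⟩
  · exact ⟨if i = j then 1 else 0, by
      rw [apply_ite (algebraMap K _), map_one, map_zero]; exact del_mul_x K i j⟩
  · exact ⟨0, by rw [map_zero, add_zero]; exact del_mul_del K i j⟩

lemma gen_pow_mem_homogeneousPart (d : ι → ℕ) (s : ι ⊕ ι) (l : ℕ) :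
    gen K s ^ l ∈ homogeneousPart K d (l * genDegree d s) :=
  Submodule.subset_span ⟨List.replicate l s, by simp, by simp⟩

lemma monomialX_mem_homogeneousPart (d : ι → ℕ) (w : List ι) :
    monomialX K w ∈ homogeneousPart K d (w.map fun i => (d i : ℤ)).sum := by
  refine Submodule.subset_span ⟨w.map Sum.inl, ?_, ?_⟩ <;> rw [List.map_map] <;> rfl

variable {M : Type*} [AddCommGroup M] [Module (Weyl K ι) M]

lemma exists_gen_pow_smul_smul_eq_zero (s : ι ⊕ ι) (a : Weyl K ι) {m : M}
    (hm : ∃ k : ℕ, gen K s ^ k • m = 0) : ∃ k : ℕ, gen K s ^ k • a • m = 0 := by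
  have hgen (t : ι ⊕ ι) {m : M} (hm : ∃ k : ℕ, gen K s ^ k • m = 0) :
      ∃ k : ℕ, gen K s ^ k • gen K t • m = 0 := by
    obtain ⟨k, hk⟩ := hm
    obtain ⟨c, hc⟩ := exists_gen_mul_gen (K := K) t s
    have hk' : gen K s ^ (k + 1) • m = 0 := by rw [pow_succ', mul_smul, hk, smul_zero]
    have h := congrArg (· • m) (mul_pow_succ_of_mul_eq_add (Algebra.commutes c _).symm hc k)
    refine ⟨k + 1, ?_⟩
    simpa [add_smul, mul_smul, smul_assoc, hk, hk'] using h.symm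
  induction a using weyl_induction generalizing m with
  | h0 c =>
    obtain ⟨k, hk⟩ := hm
    exact ⟨k, by rw [smul_smul, ← Algebra.commutes, mul_smul, hk, smul_zero]⟩
  | hx i => exact hgen (.inl i) hm
  | hd i => exact hgen (.inr i) hm
  | hadd a b ha hb => exact add_smul a b m ▸ exists_pow_smul_add_eq_zero (ha hm) (hb hm)
  | hmul a b ha hb => exact mul_smul a b m ▸ ha (hb hm)

variable (K M) in
/-- The elements of `M` on which each generator of the Weyl algebra in `R` acts locally
nilpotently. When `R` consists of coordinates `xᵢ`, these are the sections of `M` supported on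
the linear subspace where these coordinates vanish. -/
def nilpotentPart (R : Set (ι ⊕ ι)) : Submodule (Weyl K ι) M where
  carrier := {m | ∀ s ∈ R, ∃ k : ℕ, gen K s ^ k • m = 0}
  zero_mem' _ _ := ⟨0, smul_zero _⟩
  add_mem' hm hn s hs := exists_pow_smul_add_eq_zero (hm s hs) (hn s hs)
  smul_mem' a _ hm s hs := exists_gen_pow_smul_smul_eq_zero s a (hm s hs)

lemma nilpotentPart_empty : nilpotentPart K M (∅ : Set (ι ⊕ ι)) = ⊤ :=
  eq_top_iff.2 fun _ _ _ hs => hs.elim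

lemma mem_nilpotentPart_insert {R : Set (ι ⊕ ι)} {s : ι ⊕ ι} {m : M}
    (hm : m ∈ nilpotentPart K M R) (h : ∃ k : ℕ, gen K s ^ k • m = 0) :
    m ∈ nilpotentPart K M (insert s R) :=
  Set.forall_mem_insert.2 ⟨h, hm⟩

lemma eq_zero_of_algebraMap_smul_eq_zero {c : K} (hc : c ≠ 0) {m : M}
    (h : algebraMap K (Weyl K ι) c • m = 0) : m = 0 :=
  ((hc.isUnit.map (algebraMap K (Weyl K ι))).smul_eq_zero).1 h

lemma nilpotentPart_eq_bot [CharZero K] {R : Set (ι ⊕ ι)} {i : ι} (hx : Sum.inl i ∈ R)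
    (hdel : Sum.inr i ∈ R) : nilpotentPart K M R = ⊥ := by
  refine (Submodule.eq_bot_iff _).2 fun m hm => by_contra fun hm0 => ?_
  obtain ⟨l, hn, hdeln⟩ := exists_pow_smul_ne_zero hm0 (hm _ hdel)
  rw [pow_succ', mul_smul] at hdeln
  set n := gen K (.inr i) ^ l • m
  obtain ⟨k, hk, hxn⟩ := exists_pow_smul_ne_zero hn (Submodule.smul_mem _ _ hm _ hx)
  have hcomm : del K i * x K i = x K i * del K i + 1 := by rw [del_mul_x, if_pos rfl]
  have hkx : algebraMap K (Weyl K ι) (k + 1) • gen K (.inl i) ^ k • n = 0 := by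
    have h := congrArg (· • n) (mul_pow_succ_of_mul_eq_add (Commute.one_right _) hcomm k)
    simpa [add_smul, mul_smul, x, del, hdeln, hxn] using h.symm
  exact hk (eq_zero_of_algebraMap_smul_eq_zero k.cast_add_one_ne_zero hkx)

end Nilpotent

section Degrees

variable {K : Type u} [Field K] {ι : Type} [Fintype ι] [DecidableEq ι] {d : ι → ℕ} {lam : K}
variable {M : Type u} [AddCommGroup M] [Module (Weyl K ι) M]

lemma gen_pow_smul_mem_weightSpace {k : ℤ} (s : ι ⊕ ι) (l : ℕ) {m : M}
    (hm : m ∈ weightSpace d (lam + k) M) :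
    gen K s ^ l • m ∈ weightSpace d (lam + (k + l * genDegree d s : ℤ)) M := by
  simpa only [Int.cast_add, add_assoc] using
    smul_mem_weightSpace d (gen_pow_mem_homogeneousPart d s l) hm

variable (d lam) in
/-- The integers `k` such that the submodule `N` contains a nonzero vector of weight `lam + k`,
that is, the degrees in which the graded module `N` does not vanish when `M` is `lam`-Euler. -/
def degrees (N : Submodule (Weyl K ι) M) : Set ℤ :=
  {k | ∃ m ∈ N, m ∈ weightSpace d (lam + k) M ∧ m ≠ 0}

lemma genDegree_mem_shifts_degrees {R : Set (ι ⊕ ι)} {s : ι ⊕ ι}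
    (hs : ¬ (degrees d lam (nilpotentPart K M (insert s R))).Nonempty) :
    genDegree d s ∈ shifts (degrees d lam (nilpotentPart K M R)) := by
  rintro k ⟨m, hmR, hm, hm0⟩
  refine ⟨gen K s • m, Submodule.smul_mem _ _ hmR, ?_, fun hsm => hs ⟨k, m, ?_, hm, hm0⟩⟩
  · simpa using gen_pow_smul_mem_weightSpace s 1 hm
  · exact mem_nilpotentPart_insert hmR ⟨1, by rw [pow_one, hsm]⟩

lemma exists_forall_gen_smul_eq_zero {σ : Type*} [Finite σ] {f : σ → ι ⊕ ι} {R : Set (ι ⊕ ι)}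
    (hf : ∀ a, f a ∈ R) (hcomm : ∀ a b, Commute (gen K (f a)) (gen K (f b)))
    (hne : (degrees d lam (nilpotentPart K M R)).Nonempty) :
    ∃ k : ℤ, ∃ m ∈ nilpotentPart K M R, m ∈ weightSpace d (lam + k) M ∧ m ≠ 0 ∧
      ∀ a, gen K (f a) • m = 0 := by
  classical
  have := Fintype.ofFinite σ
  suffices ∀ T : Finset σ, ∃ k : ℤ, ∃ m ∈ nilpotentPart K M R, m ∈ weightSpace d (lam + k) M ∧
      m ≠ 0 ∧ ∀ a ∈ T, gen K (f a) • m = 0 by simpa using this Finset.univ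
  intro T
  induction T using Finset.induction_on with
  | empty =>
    obtain ⟨k, m, hmR, hm, hm0⟩ := hne
    exact ⟨k, m, hmR, hm, hm0, by simp⟩
  | insert b T _ ih =>
    obtain ⟨k, m, hmR, hm, hm0, hmT⟩ := ih
    obtain ⟨l, hl, hbl⟩ := exists_pow_smul_ne_zero hm0 (hmR (f b) (hf b))
    refine ⟨_, _, Submodule.smul_mem _ _ hmR, gen_pow_smul_mem_weightSpace (f b) l hm, hl, ?_⟩
    refine (Finset.forall_mem_insert _ _ _).2 ⟨by rw [smul_smul, ← pow_succ', hbl], fun a ha => ?_⟩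
    rw [smul_smul, ((hcomm a b).pow_right l).eq, mul_smul, hmT a ha, smul_zero]

lemma degrees_top_nonempty [Nontrivial M] (hM : IsEuler d lam M) :
    (degrees d lam (⊤ : Submodule (Weyl K ι) M)).Nonempty := by
  by_contra! hempty
  have hbot (k : ℤ) : weightSpace d (lam + k) M = ⊥ :=
    (AddSubgroup.eq_bot_iff_forall _).2 fun m hm => by_contra fun hm0 =>
      Set.eq_empty_iff_forall_notMem.1 hempty k ⟨m, trivial, hm, hm0⟩
  rw [IsEuler, iSup_congr hbot, iSup_bot] at hM
  exact bot_ne_top hM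

lemma weight_eq_zero_of_del_smul_eq_zero {μ : K} {m : M} (hm : m ∈ weightSpace d μ M)
    (hm0 : m ≠ 0) (hdel : ∀ i : ι, del K i • m = 0) : μ = 0 := by
  by_contra hμ
  have hE : euler K d • m = 0 := by simp [euler, Finset.sum_smul, mul_smul, hdel]
  exact hm0 (eq_zero_of_algebraMap_smul_eq_zero hμ (Eq.trans hm.symm hE))

lemma mem_torsionSubmodule_of_x_smul_eq_zero {m : M} (hx : ∀ i : ι, x K i • m = 0) :
    m ∈ torsionSubmodule K ι M := by
  refine ⟨1, fun w hw => ?_⟩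
  obtain ⟨i, rfl⟩ := List.length_eq_one_iff.1 hw
  simp [monomialX_cons, monomialX_nil, hx]

lemma exists_inl_notMem {R : Set (ι ⊕ ι)}
    (htors : ∀ k : ℤ, ∀ m ∈ weightSpace d (lam + k) M, m ∈ torsionSubmodule K ι M → m = 0)
    (hne : (degrees d lam (nilpotentPart K M R)).Nonempty) : ∃ i, Sum.inl i ∉ R := by
  by_contra! hR
  obtain ⟨k, m, -, hm, hm0, hx⟩ := exists_forall_gen_smul_eq_zero hR (x_mul_x K) hne
  exact hm0 (htors k m hm (mem_torsionSubmodule_of_x_smul_eq_zero hx))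

lemma exists_mem_degrees_add_eq_zero {R : Set (ι ⊕ ι)} (hR : ∀ i, Sum.inr i ∈ R)
    (hne : (degrees d lam (nilpotentPart K M R)).Nonempty) :
    ∃ k ∈ degrees d lam (nilpotentPart K M R), lam + k = 0 := by
  obtain ⟨k, m, hmR, hm, hm0, hdel⟩ := exists_forall_gen_smul_eq_zero hR (del_mul_del K) hne
  exact ⟨k, ⟨m, hmR, hm, hm0⟩, weight_eq_zero_of_del_smul_eq_zero hm hm0 hdel⟩

theorem zero_mem_degrees_of_gcd_eq_one [CharZero K] (hd : ∀ i, 0 < d i)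
    (hgcd : Finset.univ.gcd d = 1)
    (hlam : lam ∈ (Set.range (Int.cast : ℤ → K))ᶜ ∪
      (Nat.cast : ℕ → K) '' (AddSubmonoid.closure (Set.range d) : Set ℕ))
    (htors : ∀ k : ℤ, ∀ m ∈ weightSpace d (lam + k) M, m ∈ torsionSubmodule K ι M → m = 0)
    (hne : (degrees d lam (⊤ : Submodule (Weyl K ι) M)).Nonempty) :
    0 ∈ degrees d lam (⊤ : Submodule (Weyl K ι) M) := by
  obtain ⟨R, hR⟩ := (Set.toFinite {R : Set (ι ⊕ ι) |
    (degrees d lam (nilpotentPart K M R)).Nonempty}).exists_maximal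
      ⟨∅, by simpa [nilpotentPart_empty] using hne⟩
  set P := degrees d lam (nilpotentPart K M R)
  have hshift {s : ι ⊕ ι} (hs : s ∉ R) : genDegree d s ∈ shifts P :=
    genDegree_mem_shifts_degrees fun h => hs (hR.2 h (Set.subset_insert s R) (Set.mem_insert s R))
  have hx {i : ι} (hi : Sum.inl i ∉ R) : (d i : ℤ) ∈ shifts P := by
    simpa [genDegree] using hshift hi
  have hdel {i : ι} (hi : Sum.inr i ∉ R) : -(d i : ℤ) ∈ shifts P := by
    simpa [genDegree] using hshift hi
  have hpair (i : ι) : Sum.inl i ∉ R ∨ Sum.inr i ∉ R := by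
    by_contra! h
    obtain ⟨k, m, hmR, -, hm0⟩ := hR.1
    exact hm0 ((Submodule.mem_bot _).1 (nilpotentPart_eq_bot (K := K) (M := M) h.1 h.2 ▸ hmR))
  suffices h0 : 0 ∈ P from h0.imp fun m hm => ⟨trivial, hm.2⟩
  obtain ⟨i, hi⟩ := exists_inl_notMem htors hR.1
  by_cases hall : ∀ j, Sum.inr j ∈ R
  · obtain ⟨k, hk, hlk⟩ := exists_mem_degrees_add_eq_zero hall hR.1
    exact zero_mem_of_natCast_add_eq_zero hk hlam
      (fun j => hx ((hpair j).resolve_right (not_not.2 (hall j)))) hlk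
  · obtain ⟨j, hj⟩ := not_forall.1 hall
    have hP : shifts P = ⊤ := addSubmonoid_eq_top_of_gcd_eq_one hgcd
      (fun i _ => (hpair i).imp hx hdel) (hx hi) (Int.natCast_pos.2 (hd i))
      (hdel hj) (neg_neg_of_pos (Int.natCast_pos.2 (hd j)))
    obtain ⟨k, hk⟩ := hR.1
    have hneg : -k ∈ shifts P := by rw [hP]; trivial
    exact add_neg_cancel k ▸ hneg k hk

end Degrees

section Localization

variable {C D : Type*} [Category* C] [Category* D] {L : C ⥤ D}

lemma isIso_counit_of_isLocalization {R : D ⥤ C} (adj : L ⊣ R) (W : MorphismProperty C)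
    [L.IsLocalization W] : IsIso adj.counit := by
  let α : 𝟭 D ⟶ R ⋙ L := Localization.liftNatTrans L W L (L ⋙ R ⋙ L) (𝟭 D) (R ⋙ L)
    (Functor.whiskerRight adj.unit L)
  have hα (X : C) : α.app (L.obj X) = L.map (adj.unit.app X) := by simp [α]
  refine ⟨α, ?_, ?_⟩
  · ext Y
    calc adj.counit.app Y ≫ α.app Y
        = α.app (L.obj (R.obj Y)) ≫ L.map (R.map (adj.counit.app Y)) :=
          α.naturality (adj.counit.app Y)
      _ = 𝟙 (L.obj (R.obj Y)) := by
          rw [hα, ← L.map_comp, adj.right_triangle_components]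
          exact L.map_id _
  · refine Localization.natTrans_ext L W fun X => ?_
    simp [hα]

lemma isLocal_isLocal_of_isIso_map (W : MorphismProperty C) [L.IsLocalization W] {X Y : C}
    (f : X ⟶ Y) [IsIso (L.map f)] : W.isLocal.isLocal f := by
  intro Z hZ
  let F := (yoneda.obj Z).rightOp
  have hF : W.IsInvertedBy F := fun A B g hg => by
    rw [← isIso_unop_iff, isIso_iff_bijective]
    exact hZ g hg
  have : IsIso (F.map f) := (NatIso.isIso_map_iff (Localization.fac F hF L) f).1 <|
    inferInstanceAs (IsIso ((Localization.lift F hF L).map (L.map f)))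
  rwa [← isIso_unop_iff, isIso_iff_bijective] at this

lemma isLocal_rightAdjoint_obj {R : D ⥤ C} (adj : L ⊣ R) (W : MorphismProperty C)
    [L.IsLocalization W] [R.Full] [R.Faithful] (Y : D) : W.isLocal (R.obj Y) := by
  refine (ObjectProperty.le_isLocal_iff (· ∈ Set.range R.obj) W).1 (fun _ _ f hf => ?_) _ ⟨Y, rfl⟩
  exact (ObjectProperty.isLocal_iff_isIso_map adj f).2 (Localization.inverts L W f hf)

end Localization

section TwistedDMod

variable {K : Type u} [Field K] {ι : Type} [Fintype ι] [DecidableEq ι] {d : ι → ℕ} {lam : K}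

variable (d lam) in
lemma isIso_sectionAdjunction_counit : IsIso (sectionAdjunction d lam).counit :=
  isIso_counit_of_isLocalization (sectionAdjunction d lam) (torsionIso d lam)

instance : (sectionFunctor d lam).Full :=
  have := isIso_sectionAdjunction_counit d lam
  (sectionAdjunction d lam).fullyFaithfulROfIsIsoCounit.full

instance : (sectionFunctor d lam).Faithful :=
  have := isIso_sectionAdjunction_counit d lam
  (sectionAdjunction d lam).fullyFaithfulROfIsIsoCounit.faithful

lemma torsionIso_of_isIso_map {M N : EulerMod d lam} (f : M ⟶ N)
    [IsIso ((quotientFunctor d lam).map f)] : torsionIso d lam f :=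
  torsionIso_of_isLocal d lam f <|
    isLocal_isLocal_of_isIso_map (L := quotientFunctor d lam) (torsionIso d lam) f

lemma torsionIso_unit (M : EulerMod d lam) :
    torsionIso d lam ((sectionAdjunction d lam).unit.app M) :=
  torsionIso_of_isIso_map _

lemma isLocal_sectionFunctor_obj (ℳ : TwistedDMod d lam) :
    (torsionIso d lam).isLocal ((sectionFunctor d lam).obj ℳ) :=
  isLocal_rightAdjoint_obj (sectionAdjunction d lam) (torsionIso d lam) ℳ

lemma torsionIso_zero_iff {M N : EulerMod d lam} :
    torsionIso d lam (0 : M ⟶ N) ↔ IsTorsion K ι M.obj ∧ IsTorsion K ι N.obj := by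
  refine and_congr ?_ ?_
  · rw [isTorsion_ker_iff]
    exact ⟨fun h => eq_top_iff.2 fun m _ => h m rfl, fun h m _ => h ▸ Submodule.mem_top⟩
  · rw [isTorsion_quotient_iff]
    have : LinearMap.range (EulerMod.lin (0 : M ⟶ N)) = ⊥ := LinearMap.range_zero
    rw [this, IsTorsion, torsionSubmodule]

lemma isTorsion_of_isZero_quotientFunctor_obj {M : EulerMod d lam}
    (hM : Limits.IsZero ((quotientFunctor d lam).obj M)) : IsTorsion K ι M.obj := by
  have := hM.isIso hM ((quotientFunctor d lam).map (0 : M ⟶ M))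
  exact (torsionIso_zero_iff.1 (torsionIso_of_isIso_map (0 : M ⟶ M))).1

lemma hom_eq_zero_of_isTorsion {N S : EulerMod d lam} (hN : IsTorsion K ι N.obj)
    (hS : (torsionIso d lam).isLocal S) (f : N ⟶ S) : f = 0 :=
  (hS (0 : N ⟶ N) (torsionIso_zero_iff.2 ⟨hN, hN⟩)).1 (by simp)

lemma eq_zero_of_mem_torsionSubmodule {S : EulerMod d lam}
    (hS : (torsionIso d lam).isLocal S) {k : ℤ} {m : S.obj}
    (hm : m ∈ weightSpace d (lam + k) S.obj) (hmt : m ∈ torsionSubmodule K ι S.obj) : m = 0 := by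
  let T := eulerPart d lam (torsionSubmodule K ι S.obj)
  let N : EulerMod d lam := ⟨ModuleCat.of _ T, isEuler_eulerPart d lam _⟩
  have hN : IsTorsion K ι N.obj := eq_top_iff.2 fun t _ =>
    mem_torsionModulo_of_map T.subtype (L' := ⊥) (by simp) (eulerPart_le d lam _ t.2)
  let incl : N ⟶ S := ObjectProperty.homMk (ModuleCat.ofHom T.subtype)
  have hincl : incl = 0 := hom_eq_zero_of_isTorsion hN hS incl
  have hmT : m ∈ T := AddSubgroup.subset_closure ⟨hmt, k, hm⟩
  exact LinearMap.congr_fun (congrArg EulerMod.lin hincl) (⟨m, hmT⟩ : T)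

lemma kernelGlobalSections_iff (ℳ : TwistedDMod d lam) :
    kernelGlobalSections d lam ℳ ↔ weightSpace d lam ((sectionFunctor d lam).obj ℳ).obj = ⊥ := by
  rw [kernelGlobalSections, ModuleCat.isZero_iff_subsingleton]
  change Subsingleton (weightSpace d lam ((sectionFunctor d lam).obj ℳ).obj) ↔ _
  exact ⟨fun _ => AddSubgroup.eq_bot_of_subsingleton _, fun h => h ▸ inferInstance⟩

lemma isZero_of_subsingleton_sectionFunctor_obj {ℳ : TwistedDMod d lam}
    [Subsingleton ((sectionFunctor d lam).obj ℳ).obj] : Limits.IsZero ℳ :=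
  .of_full_of_faithful_of_isZero (sectionFunctor d lam ⋙ ObjectProperty.ι _) ℳ
    (ModuleCat.isZero_of_subsingleton ((sectionFunctor d lam).obj ℳ).obj)

lemma weightSpace_eq_bot_of_torsionIso {M S : EulerMod d lam} {f : M ⟶ S}
    (hf : torsionIso d lam f) (hS : (torsionIso d lam).isLocal S)
    (hM : torsionSubmodule K ι M.obj = ⊥) {k : ℤ}
    (hweight : ∀ w : List ι,
      weightSpace d (lam + (k + (w.map fun i => (d i : ℤ)).sum : ℤ)) M.obj = ⊥) :
    weightSpace d (lam + k) S.obj = ⊥ := by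
  obtain ⟨hker, hcoker⟩ := hf
  rw [isTorsion_ker_iff, hM] at hker
  rw [isTorsion_quotient_iff] at hcoker
  have hinj : Function.Injective (EulerMod.lin f) := (injective_iff_map_eq_zero _).2 hker
  refine (AddSubgroup.eq_bot_iff_forall _).2 fun s hs => eq_zero_of_mem_torsionSubmodule hS hs ?_
  obtain ⟨n, hn⟩ := hcoker ▸ Submodule.mem_top (x := s)
  refine ⟨n, fun w hw => ?_⟩
  obtain ⟨m, hm⟩ := hn w hw
  have hms := smul_mem_weightSpace d (monomialX_mem_homogeneousPart d w) hs
  rw [← hm, add_assoc, ← Int.cast_add] at hms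
  have hmw : m ∈ weightSpace d (lam + (k + (w.map fun i => (d i : ℤ)).sum : ℤ)) M.obj :=
    hinj <| by rw [map_smul, map_smul]; exact hms
  rw [hweight, AddSubgroup.mem_bot] at hmw
  rw [← hm, hmw, map_zero]
  exact zero_mem _

end TwistedDMod

section Laurent

variable {K : Type u} [Field K] {ι : Type}

/-- The twisted Laurent polynomials `x^α K[x^±1]`: the space with basis the monomials `x^(α + b)`,
`b ∈ ℤ^ι`, where the Weyl algebra acts by multiplication and formal differentiation. The
exponent `α` enters only through the action. -/
def TwistedLaurent (_α : ι → K) : Type u := (ι → ℤ) →₀ K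

namespace TwistedLaurent

variable (α : ι → K)

noncomputable instance : AddCommGroup (TwistedLaurent α) :=
  inferInstanceAs (AddCommGroup ((ι → ℤ) →₀ K))

instance : Nontrivial (TwistedLaurent α) :=
  inferInstanceAs (Nontrivial ((ι → ℤ) →₀ K))

/-- The element `c x^(α + b)`. -/
noncomputable def monomial (b : ι → ℤ) : K →+ TwistedLaurent α := Finsupp.singleAddHom b

/-- The coefficient of `x^(α + b)`. -/
noncomputable def coeff (b : ι → ℤ) : TwistedLaurent α →+ K := Finsupp.applyAddHom b

variable {α}

@[ext]
lemma ext_coeff {m n : TwistedLaurent α} (h : ∀ b, coeff α b m = coeff α b n) : m = n :=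
  Finsupp.ext h

@[elab_as_elim]
lemma induction {P : TwistedLaurent α → Prop} (zero : P 0)
    (add : ∀ m n, P m → P n → P (m + n)) (monomial : ∀ b c, P (monomial α b c))
    (m : TwistedLaurent α) : P m :=
  Finsupp.induction_linear m zero add monomial

lemma coeff_monomial [DecidableEq (ι → ℤ)] (a b : ι → ℤ) (c : K) :
    coeff α b (monomial α a c) = if a = b then c else 0 :=
  Finsupp.single_apply

variable [DecidableEq ι]

variable (α) in
/-- The action of the generators: `xᵢ` maps `x^(α + b)` to `x^(α + b + eᵢ)` and `∂ᵢ` maps it to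
`(αᵢ + bᵢ) x^(α + b - eᵢ)`. -/
noncomputable def genAction : ι ⊕ ι → Module.End K ((ι → ℤ) →₀ K)
  | Sum.inl i => Finsupp.lmapDomain K K (· + Pi.single i 1)
  | Sum.inr i => Finsupp.linearCombination K
      (fun b => Finsupp.single (b - Pi.single i 1) (α i + b i))

lemma genAction_inl_single (i : ι) (b : ι → ℤ) (c : K) :
    genAction α (Sum.inl i) (Finsupp.single b c) = Finsupp.single (b + Pi.single i 1) c :=
  Finsupp.mapDomain_single

lemma genAction_inr_single (i : ι) (b : ι → ℤ) (c : K) :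
    genAction α (Sum.inr i) (Finsupp.single b c) =
      Finsupp.single (b - Pi.single i 1) (c * (α i + b i)) := by
  rw [genAction, Finsupp.linearCombination_single, Finsupp.smul_single, smul_eq_mul]

lemma lift_genAction_eq_of_weylRel {a b : FreeAlgebra K (ι ⊕ ι)} (hab : WeylRel K ι a b) :
    FreeAlgebra.lift K (genAction α) a = FreeAlgebra.lift K (genAction α) b := by
  refine Finsupp.lhom_ext fun b c => ?_
  induction hab with
  | x_x i j =>
    simp only [map_mul, FreeAlgebra.lift_ι_apply, Module.End.mul_apply, genAction_inl_single,
      add_right_comm]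
  | del_del i j =>
    obtain rfl | hij := eq_or_ne i j
    · rfl
    · simp only [map_mul, FreeAlgebra.lift_ι_apply, Module.End.mul_apply, genAction_inr_single,
        Pi.sub_apply, Pi.single_eq_of_ne hij, Pi.single_eq_of_ne hij.symm, sub_zero,
        sub_right_comm b, mul_right_comm c]
  | del_x i j =>
    obtain rfl | hij := eq_or_ne i j
    · simp only [map_mul, map_add, if_true, map_one, FreeAlgebra.lift_ι_apply,
        Module.End.mul_apply, LinearMap.add_apply, Module.End.one_apply, genAction_inr_single,
        genAction_inl_single, Pi.add_apply, Pi.single_eq_same, add_sub_cancel_right,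
        sub_add_cancel, ← Finsupp.single_add]
      congr 1
      push_cast
      ring
    · simp only [map_mul, if_neg hij, add_zero, FreeAlgebra.lift_ι_apply,
        Module.End.mul_apply, genAction_inr_single, genAction_inl_single, Pi.add_apply,
        Pi.single_eq_of_ne hij, sub_add_eq_add_sub]

variable (α) in
/-- The Weyl algebra acting on twisted Laurent polynomials. -/
noncomputable def action : Weyl K ι →ₐ[K] Module.End K ((ι → ℤ) →₀ K) :=
  RingQuot.liftAlgHom K ⟨FreeAlgebra.lift K (genAction α), fun _ _ => lift_genAction_eq_of_weylRel⟩

lemma action_gen (s : ι ⊕ ι) : action α (gen K s) = genAction α s :=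
  (RingQuot.liftAlgHom_mkAlgHom_apply _ _ _ _).trans (FreeAlgebra.lift_ι_apply _ _)

noncomputable instance : Module (Weyl K ι) (TwistedLaurent α) :=
  Module.compHom ((ι → ℤ) →₀ K) (action α).toRingHom

lemma x_smul_monomial (i : ι) (b : ι → ℤ) (c : K) :
    x K i • monomial α b c = monomial α (b + Pi.single i 1) c :=
  (LinearMap.congr_fun (action_gen _) _).trans (genAction_inl_single i b c)

lemma del_smul_monomial (i : ι) (b : ι → ℤ) (c : K) :
    del K i • monomial α b c = monomial α (b - Pi.single i 1) (c * (α i + b i)) :=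
  (LinearMap.congr_fun (action_gen _) _).trans (genAction_inr_single i b c)

lemma algebraMap_smul_monomial (r : K) (b : ι → ℤ) (c : K) :
    algebraMap K (Weyl K ι) r • monomial α b c = monomial α b (r * c) :=
  (LinearMap.congr_fun ((action α).commutes r) _).trans (Finsupp.smul_single r b c)

lemma coeff_algebraMap_smul (r : K) (m : TwistedLaurent α) (b : ι → ℤ) :
    coeff α b (algebraMap K (Weyl K ι) r • m) = r * coeff α b m :=
  DFunLike.congr_fun (LinearMap.congr_fun ((action α).commutes r) m) b

lemma coeff_x_smul (i : ι) (m : TwistedLaurent α) (b : ι → ℤ) :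
    coeff α (b + Pi.single i 1) (x K i • m) = coeff α b m := by
  classical
  induction m using induction with
  | zero => rw [smul_zero, map_zero, map_zero]
  | add m n hm hn => rw [smul_add, map_add, hm, hn, map_add]
  | monomial a c => simp only [x_smul_monomial, coeff_monomial, add_left_inj]

lemma eq_zero_of_x_smul_eq_zero {i : ι} {m : TwistedLaurent α} (h : x K i • m = 0) : m = 0 :=
  ext_coeff fun b => by rw [← coeff_x_smul i, h, map_zero, map_zero]

variable [Fintype ι]

lemma torsionSubmodule_eq_bot [Nonempty ι] : torsionSubmodule K ι (TwistedLaurent α) = ⊥ := by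
  refine (Submodule.eq_bot_iff _).2 fun m ⟨k, hk⟩ => ?_
  have htorsfree (w : List ι) (hw : monomialX K w • m = 0) : m = 0 := by
    induction w with
    | nil => rwa [monomialX_nil, one_smul] at hw
    | cons i w ih =>
      rw [monomialX_cons, mul_smul] at hw
      exact ih (eq_zero_of_x_smul_eq_zero hw)
  exact htorsfree _ (hk (List.replicate k (Classical.arbitrary ι)) List.length_replicate)

lemma euler_smul_monomial (d : ι → ℕ) (b : ι → ℤ) (c : K) :
    euler K d • monomial α b c = monomial α b ((∑ i, d i * (α i + b i)) * c) := by
  have hterm (i : ι) : ((d i : Weyl K ι) * (x K i * del K i)) • monomial α b c =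
      monomial α b (d i * (α i + b i) * c) := by
    rw [← map_natCast (algebraMap K (Weyl K ι)), mul_smul, mul_smul, del_smul_monomial,
      x_smul_monomial, algebraMap_smul_monomial, sub_add_cancel, mul_comm c, mul_assoc]
  rw [euler, Finset.sum_smul, Finset.sum_congr rfl fun i _ => hterm i, Finset.sum_mul, map_sum]

lemma coeff_euler_smul (d : ι → ℕ) (m : TwistedLaurent α) (b : ι → ℤ) :
    coeff α b (euler K d • m) = (∑ i, d i * (α i + b i)) * coeff α b m := by
  classical
  induction m using induction with
  | zero => rw [smul_zero, map_zero, mul_zero]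
  | add m n hm hn => rw [smul_add, map_add, hm, hn, map_add, mul_add]
  | monomial a c =>
    rw [euler_smul_monomial, coeff_monomial, coeff_monomial, mul_ite, mul_zero]
    exact ite_congr rfl (fun hab => by rw [hab]) fun _ => rfl

variable {d : ι → ℕ} {lam : K} {l : ℤ}

lemma isEuler (hα : ∑ i, d i * α i = lam + l) : IsEuler d lam (TwistedLaurent α) := by
  refine eq_top_iff.2 fun m _ => ?_
  induction m using induction with
  | zero => exact zero_mem _
  | add m n hm hn => exact add_mem (hm trivial) (hn trivial)
  | monomial b c =>
    refine AddSubgroup.mem_iSup_of_mem (l + ∑ i, d i * b i) ?_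
    change euler K d • _ = _
    rw [euler_smul_monomial, algebraMap_smul_monomial]
    simp only [mul_add, Finset.sum_add_distrib, hα]
    push_cast
    rw [add_assoc]

lemma weightSpace_eq_bot [CharZero K] (hα : ∑ i, d i * α i = lam + l) {k : ℤ}
    (hk : ¬ ((Finset.univ.gcd d : ℕ) : ℤ) ∣ k - l) :
    weightSpace d (lam + k) (TwistedLaurent α) = ⊥ := by
  refine (AddSubgroup.eq_bot_iff_forall _).2 fun m hm => ext_coeff fun b => ?_
  rw [map_zero]
  by_contra hb
  have hcoeff := coeff_euler_smul d m b
  rw [show euler K d • m = _ from hm, coeff_algebraMap_smul] at hcoeff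
  have hweight := mul_right_cancel₀ hb hcoeff
  simp only [mul_add, Finset.sum_add_distrib, hα, add_assoc, add_right_inj] at hweight
  have hkl : k - l = ∑ i, d i * b i := sub_eq_of_eq_add' (by exact_mod_cast hweight)
  exact hk <| hkl ▸ Finset.dvd_sum fun i hi =>
    (Int.natCast_dvd_natCast.2 (Finset.gcd_dvd hi)).mul_right _

end TwistedLaurent

end Laurent

section KernelOfGlobalSections

variable {K : Type u} [Field K] [CharZero K] {ι : Type} [Fintype ι] [DecidableEq ι]
  {d : ι → ℕ} {lam : K}

theorem isZero_of_kernelGlobalSections (hd : ∀ i, 0 < d i) (hgcd : Finset.univ.gcd d = 1)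
    (hlam : lam ∈ (Set.range (Int.cast : ℤ → K))ᶜ ∪
      (Nat.cast : ℕ → K) '' (AddSubmonoid.closure (Set.range d) : Set ℕ))
    {ℳ : TwistedDMod d lam} (hℳ : kernelGlobalSections d lam ℳ) : Limits.IsZero ℳ := by
  rw [kernelGlobalSections_iff] at hℳ
  have hlocal := isLocal_sectionFunctor_obj ℳ
  set S := (sectionFunctor d lam).obj ℳ
  have hS : Subsingleton S.obj := by
    by_contra hne
    rw [not_subsingleton_iff_nontrivial] at hne
    obtain ⟨m, -, hm, hm0⟩ := zero_mem_degrees_of_gcd_eq_one hd hgcd hlam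
      (fun _ _ => eq_zero_of_mem_torsionSubmodule hlocal) (degrees_top_nonempty S.property)
    rw [Int.cast_zero, add_zero, hℳ] at hm
    exact hm0 hm
  exact isZero_of_subsingleton_sectionFunctor_obj

theorem exists_kernelGlobalSections_not_isZero (hgcd : 1 < Finset.univ.gcd d) (lam : K) :
    ∃ ℳ : TwistedDMod d lam, kernelGlobalSections d lam ℳ ∧ ¬ Limits.IsZero ℳ := by
  obtain ⟨j, hj⟩ : ∃ j, d j ≠ 0 := by
    simpa only [ne_eq, Finset.gcd_eq_zero_iff, Finset.mem_univ, true_imp_iff, not_forall]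
      using (zero_lt_one.trans hgcd).ne'
  have : Nonempty ι := ⟨j⟩
  obtain ⟨α, hα⟩ := exists_sum_mul_eq hj (lam + (1 : ℤ))
  let M : EulerMod d lam := ⟨ModuleCat.of _ (TwistedLaurent α), TwistedLaurent.isEuler hα⟩
  have htors : torsionSubmodule K ι M.obj = ⊥ :=
    TwistedLaurent.torsionSubmodule_eq_bot (α := α)
  refine ⟨(quotientFunctor d lam).obj M, (kernelGlobalSections_iff _).2 ?_, fun hM => ?_⟩
  · suffices weightSpace d (lam + (0 : ℤ)) _ = ⊥ by simpa only [Int.cast_zero, add_zero] using this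
    refine weightSpace_eq_bot_of_torsionIso (torsionIso_unit M) (isLocal_sectionFunctor_obj _) htors
      fun w => TwistedLaurent.weightSpace_eq_bot hα fun hdvd => ?_
    have hsum : ((Finset.univ.gcd d : ℕ) : ℤ) ∣ (w.map fun i => (d i : ℤ)).sum :=
      List.dvd_sum fun e he => by
        obtain ⟨i, -, rfl⟩ := List.mem_map.1 he
        exact Int.natCast_dvd_natCast.2 (Finset.gcd_dvd (Finset.mem_univ i))
    rw [zero_add] at hdvd
    exact hgcd.ne' (Nat.dvd_one.1 (Int.natCast_dvd_natCast.1 ((dvd_sub_right hsum).1 hdvd)))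
  · have htop : torsionSubmodule K ι M.obj = ⊤ := isTorsion_of_isZero_quotientFunctor_obj hM
    have : Nontrivial M.obj := inferInstanceAs (Nontrivial (TwistedLaurent α))
    exact bot_ne_top (htors ▸ htop)

end KernelOfGlobalSections

end WeightedDMod

theorem mainTheorem3_general {K : Type u} [Field K] [CharZero K] {ι : Type} [Fintype ι]
    [DecidableEq ι] (d : ι → ℕ) :
    ((∀ i, 0 < d i) → Finset.univ.gcd d = 1 →
      ∀ lam : K,
        lam ∈ (Set.range (Int.cast : ℤ → K))ᶜ ∪
          (Nat.cast : ℕ → K) '' (AddSubmonoid.closure (Set.range d) : Set ℕ) →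
        ∀ ℳ : WeightedDMod.TwistedDMod d lam,
          WeightedDMod.kernelGlobalSections d lam ℳ → Limits.IsZero ℳ) ∧
    (1 < Finset.univ.gcd d →
      ∀ lam : K, ∃ ℳ : WeightedDMod.TwistedDMod d lam,
        WeightedDMod.kernelGlobalSections d lam ℳ ∧ ¬ Limits.IsZero ℳ) :=
  ⟨fun hd hgcd _ hlam _ hℳ => WeightedDMod.isZero_of_kernelGlobalSections hd hgcd hlam hℳ,
    WeightedDMod.exists_kernelGlobalSections_not_isZero⟩

theorem mainTheorem3 {K : Type u} [Field K] [CharZero K] (n : ℕ) (hn : 1 ≤ n)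
    (d : Fin (n + 1) → ℕ) (hd : ∀ i, 0 < d i) :
    (Finset.univ.gcd d = 1 →
      ∀ lam : K,
        lam ∈ (Set.range (Int.cast : ℤ → K))ᶜ ∪
          (Nat.cast : ℕ → K) '' (AddSubmonoid.closure (Set.range d) : Set ℕ) →
        ∀ ℳ : WeightedDMod.TwistedDMod d lam,
          WeightedDMod.kernelGlobalSections d lam ℳ → Limits.IsZero ℳ) ∧
    (1 < Finset.univ.gcd d →
      ∀ lam : K, ∃ ℳ : WeightedDMod.TwistedDMod d lam,
        WeightedDMod.kernelGlobalSections d lam ℳ ∧ ¬ Limits.IsZero ℳ) :=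
  have h := mainTheorem3_general (K := K) d
  ⟨h.1 hd, h.2⟩
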